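/- Let $S=\mathbb{R}^2/\mathbb{Z}^2$ be the torus with one puncture (marked point) $p$. An \emph{arc} is the homotopy class (relative to the endpoints, and up to reversal of direction) of a non-contractible curve in $S$ that starts and ends at $p$ and otherwise meets neither $p$ nor itself. The intersection number of two different arcs is the least number of points of $S\setminus\{p\}$ in which representatives of them meet; the intersection number of an arc with itself is $0$. A \emph{triangulation} is an ordered triple $M=(m_1,m_2,m_3)$ of arcs that form a maximal collection of distinct arcs which pairwise have representatives meeting only at $p$. A \emph{flip in direction $k$} exchanges $m_k$ for a different arc so that a triangulation results. For an arc $\ell$, the \emph{intersection vector} $D(M,\ell)\in\mathbb{Z}_{\ge 0}^3$ has as its $i$-th entry the intersection number of $\ell$ and $m_i$. Let $\mathbb{T}_3$ be the $3$-regular tree with edges labelled $1,2,3$ such that the three edges at each vertex have different labels, let $t_0$ be a vertex of it, let $t_1$ be the vertex joined to $t_0$ by the edge labelled $3$, and let $\mathbb{T}_3'$ be the full subtree of all vertices that can be reached from $t_1$ without going through $t_0$, with root $t_1$. Let $L=(\ell_1,\ell_2,\ell_3)$ be any triangulation. (1) There is exactly one assignment $t\mapsto L_t$ of triangulations to the vertices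 of $\mathbb{T}_3$ (the \emph{cluster pattern} of $L$) such that $L_{t_0}=L$ and, whenever $t,t'$ are joined by an edge labelled $k$, the triangulations $L_t$ and $L_{t'}$ are obtained from each other by a flip in direction $k$. The \emph{initial intersection vector tree} is the tree $\mathbb{T}_3'$ with the vector $D(L_t,\ell_3)=(d_{1;t},d_{2;t},d_{3;t})^{T}$ standing at each vertex $t$. (2) There is exactly one well-defined map $h\colon\{D(L_t,\ell_3)\}_{t\in\mathbb{T}_3'}\to\mathbb{Q}$ given inductively as follows. It maps $$D(L_{t_1},\ell_3)\mapsto\frac{d_{1;t_1}+1}{d_{2;t_1}+1}=\frac11 .$$ If $\{a,b,c\}=\{1,2,3\}$, $D(L_t,\ell_3)$ has been mapped to $\dfrac{d_{a;t}+1}{d_{b;t}+1}$, and $t,t'$ are joined by an edge labelled $k$ with $t'$ farther from $t_1$ than $t$, then $$D(L_{t'},\ell_3)\mapsto\frac{d_{c;t}+1}{d_{b;t}+1}\ \text{ if } k=a,\qquad D(L_{t'},\ell_3)\mapsto\frac{d_{a;t}+1}{d_{c;t}+1}\ \text{ if } k=b,$$ the index pair being $(c,b)$, respectively $(a,c)$,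 at $t'$. (3) Replacing each vertex $v$ of the initial intersection vector tree by $h(v)$ gives exactly the Calkin--Wilf tree, with its root and its edge labels; moreover, if $(a,b)$ is the index pair at $t$, then $d_{a;t}+1$ and $d_{b;t}+1$ are the numerator and the denominator of the corresponding fraction of the Calkin--Wilf tree. Here the Calkin--Wilf tree is the full binary tree of fractions with root $\frac11$ in which $\frac xy$ has the left child $\frac{x}{x+y}$ and the right child $\frac{x+y}{y}$. Its edges are labelled as follows: the edge from $\frac11$ to $\frac21$ has the label $1$ and the edge from $\frac11$ to $\frac12$ the label $2$; if the edges from a vertex to its left and right child have the labels $a$ and $b$, and $\{a,b,c\}=\{1,2,3\}$, then the edges from the left child to its left and right child have the labels $c$ and $b$, and those from the right child have the labels $a$ and $c$. -/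

import Mathlib

namespace PuncturedTorus

/-! Labels and positions `1, 2, 3` are written `0, 1, 2 : Fin 3` throughout. -/

/-! ### Arcs on the one-punctured torus -/

/-- The torus `ℝ² / ℤ²`. -/
abbrev Torus : Type := AddCircle (1 : ℝ) × AddCircle (1 : ℝ)

/-- The puncture `p`. -/
def puncture : Torus := (0, 0)

/-- A curve representing an arc: both endpoints are the puncture, it meets neither itself nor
the puncture apart from its endpoints, and it cannot be contracted to the puncture. -/
structure ArcCurve where
  path : Path puncture puncture
  simple : ∀ s t : unitInterval, path s = path t → s = t ∨ (s = 0 ∧ t = 1) ∨ (s = 1 ∧ t = 0)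
  essential : ¬ path.Homotopic (Path.refl puncture)

/-- Homotopy with fixed endpoints, up to reversal: arcs carry no orientation. -/
instance arcSetoid : Setoid ArcCurve where
  r γ δ := γ.path.Homotopic δ.path ∨ γ.path.Homotopic δ.path.symm
  iseqv :=
    { refl := fun γ => Or.inl (Path.Homotopic.refl γ.path)
      symm := by
        rintro γ δ (h | h)
        · exact Or.inl h.symm
        · refine Or.inr ?_
          have := h.symm₂
          rw [Path.symm_symm] at this
          exact this.symm
      trans := by
        rintro γ δ ε (h | h) (h' | h')
        · exact Or.inl (h.trans h')
        · exact Or.inr (h.trans h')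
        · exact Or.inr (h.trans h'.symm₂)
        · refine Or.inl (h.trans ?_)
          have := h'.symm₂
          rwa [Path.symm_symm] at this }

/-- Arcs: homotopy classes of arc curves. -/
def Arc : Type := Quotient arcSetoid

/-- The arc represented by a curve. -/
def ArcCurve.arc (γ : ArcCurve) : Arc := Quotient.mk arcSetoid γ

/-- The points away from the puncture in which two curves meet. -/
def ArcCurve.crossings (γ δ : ArcCurve) : Set Torus :=
  (Set.range γ.path ∩ Set.range δ.path) \ {puncture}

/-- Two arcs are compatible if they have representatives that meet only at the puncture. -/
def Arc.Compatible (α β : Arc) : Prop :=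
  ∃ γ δ : ArcCurve, γ.arc = α ∧ δ.arc = β ∧ γ.crossings δ = ∅

open Classical in
/-- The least number of points in which representatives of two arcs meet away from the puncture;
the intersection number of an arc with itself is `0`. Only pairs of representatives with finitely
many common points compete, as `encard` has to be a natural number. -/
noncomputable def Arc.intersectionNumber (α β : Arc) : ℕ :=
  if α = β then 0
  else sInf {n : ℕ | ∃ γ δ : ArcCurve, γ.arc = α ∧ δ.arc = β ∧ (γ.crossings δ).encard = n}

/-! ### Triangulations, flips and intersection vectors -/

/-- An ordered triple of arcs is a triangulation if it is a maximal collection of distinct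
pairwise compatible arcs. -/
structure IsTriangulation (M : Fin 3 → Arc) : Prop where
  distinct : Function.Injective M
  compatible : ∀ i j, i ≠ j → (M i).Compatible (M j)
  maximal : ∀ α : Arc, (∀ i, α.Compatible (M i)) → ∃ i, α = M i

/-- The triangulation `M'` is obtained from the triangulation `M` by a flip in direction `k`:
the `k`-th arc is exchanged for another one. -/
structure IsFlip (k : Fin 3) (M M' : Fin 3 → Arc) : Prop where
  source : IsTriangulation M
  target : IsTriangulation M'
  fixed : ∀ j, j ≠ k → M' j = M j
  exchanged : M' k ≠ M k

/-- The intersection vector `D(M, ℓ)`. -/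
noncomputable def intersectionVector (M : Fin 3 → Arc) (ℓ : Arc) : Fin 3 → ℕ :=
  fun i => ℓ.intersectionNumber (M i)

/-! ### The 3-regular tree -/

/-- Vertices of the 3-regular tree with edges labelled `1, 2, 3`: a vertex is the sequence of the
labels met on the way from the rooted vertex to it, the last one at the head of the list.
Such a sequence is any sequence without equal neighbours. -/
def T3 : Type := {w : List (Fin 3) // w.IsChain (· ≠ ·)}

/-- The rooted vertex `t₀`. -/
def T3.t0 : T3 := ⟨[], List.isChain_nil⟩

/-- `t` and `t'` are joined by an edge labelled `k`. -/
def T3.Edge (k : Fin 3) (t t' : T3) : Prop := t'.1 = k :: t.1 ∨ t.1 = k :: t'.1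

/-- Every vertex is an endpoint of exactly one edge with a given label. -/
theorem T3.existsUnique_edge (t : T3) (k : Fin 3) : ∃! t' : T3, T3.Edge k t t' := by
  obtain ⟨w, hw⟩ := t
  rcases w with _ | ⟨a, w⟩
  · refine ⟨⟨[k], List.isChain_singleton k⟩, Or.inl rfl, ?_⟩
    rintro ⟨w', hw'⟩ (h | h)
    · exact Subtype.ext h
    · simp at h
  · by_cases hak : a = k
    · subst hak
      refine ⟨⟨w, hw.tail⟩, Or.inr rfl, ?_⟩
      rintro ⟨w', hw'⟩ (h | h)
      · simp only at h
        subst h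
        simp at hw'
      · simp only [List.cons.injEq, true_and] at h
        exact Subtype.ext h.symm
    · refine ⟨⟨k :: a :: w, List.isChain_cons_cons.2 ⟨Ne.symm hak, hw⟩⟩, Or.inl rfl, ?_⟩
      rintro ⟨w', hw'⟩ (h | h)
      · exact Subtype.ext h
      · simp only [List.cons.injEq] at h
        exact absurd h.1 hak

/-- An assignment of triangulations to the vertices of the 3-regular tree is a cluster pattern
with the initial triangulation `L` if `L` sits at `t₀` and triangulations joined by an edge
labelled `k` are obtained from each other by a flip in direction `k`. -/
structure IsClusterPattern (L : Fin 3 → Arc) (P : T3 → Fin 3 → Arc) : Prop where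
  initial : P T3.t0 = L
  flip : ∀ (k : Fin 3) (t t' : T3), T3.Edge k t t' → IsFlip k (P t) (P t')

/-- The vertices of the subtree behind the edge labelled `3` at `t₀`: those for which the first
label on the way from `t₀` is `3`. -/
def T3' : Type := {t : T3 // t.1.getLast? = some 2}

/-- The vertex `t₁` joined to `t₀` by the edge labelled `3`. -/
def T3'.t1 : T3' := ⟨⟨[2], List.isChain_singleton 2⟩, rfl⟩

/-- `t` and `t'` are joined by an edge labelled `k`. -/
def T3'.Edge (k : Fin 3) (t t' : T3') : Prop := T3.Edge k t.1 t'.1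

/-- `t` and `t'` are joined by an edge labelled `k`, and `t'` is the endpoint farther from `t₁`
(the distance to `t₁` is the length of the list minus one). -/
def T3'.Child (k : Fin 3) (t t' : T3') : Prop :=
  T3'.Edge k t t' ∧ t.1.1.length < t'.1.1.length

/-! ### Edge-labelled trees and the replacement of vertices -/

/-- A rooted tree with edges labelled by `1, 2, 3` and an element of `X` standing at each
vertex. -/
structure LabelledTree (X : Type) where
  Vertex : Type
  root : Vertex
  Edge : Fin 3 → Vertex → Vertex → Prop
  val : Vertex → X

/-- Replace what stands at each vertex by its image under `f`. -/
def LabelledTree.replace {X Y : Type} (T : LabelledTree X) (f : X → Y) : LabelledTree Y where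
  Vertex := T.Vertex
  root := T.root
  Edge := T.Edge
  val v := f (T.val v)

/-- Two labelled trees are the same: there is a bijection of the vertices that respects the root,
the edges with their labels, and what stands at the vertices. -/
def LabelledTree.Same {X : Type} (T U : LabelledTree X) : Prop :=
  ∃ φ : T.Vertex ≃ U.Vertex,
    φ T.root = U.root ∧
    (∀ k v w, T.Edge k v w ↔ U.Edge k (φ v) (φ w)) ∧
    ∀ v, T.val v = U.val (φ v)

/-- The vectors `D(L_t, ℓ)` for `t` in the subtree. -/
noncomputable def initialVector (P : T3 → Fin 3 → Arc) (ℓ : Arc) (t : T3') : Fin 3 → ℕ :=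
  intersectionVector (P t.1) ℓ

/-- The initial intersection vector tree: `D(L_t, ℓ)` stands at `t`. -/
noncomputable def initialIntersectionVectorTree (P : T3 → Fin 3 → Arc) (ℓ : Arc) :
    LabelledTree (Set.range (initialVector P ℓ)) where
  Vertex := T3'
  root := T3'.t1
  Edge := T3'.Edge
  val t := ⟨initialVector P ℓ t, t, rfl⟩

/-! ### The map `h` -/

/-- The inductive definition of `h` on the set of the vectors `d t`. The vector `d t` is mapped to
`(d t a + 1) / (d t b + 1)` with `a = num t` and `b = den t`; `c` is the third index. -/
structure IsRatioMap (d : T3' → Fin 3 → ℕ) (num den : T3' → Fin 3) (h : Set.range d → ℚ) :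
    Prop where
  num_root : num T3'.t1 = 0
  den_root : den T3'.t1 = 1
  root : h ⟨d T3'.t1, T3'.t1, rfl⟩ = ((d T3'.t1 0 : ℚ) + 1) / ((d T3'.t1 1 : ℚ) + 1)
  step_num : ∀ (k c : Fin 3) (t t' : T3'), T3'.Child k t t' → c ≠ num t → c ≠ den t →
    k = num t → num t' = c ∧ den t' = den t ∧
      h ⟨d t', t', rfl⟩ = ((d t c : ℚ) + 1) / ((d t (den t) : ℚ) + 1)
  step_den : ∀ (k c : Fin 3) (t t' : T3'), T3'.Child k t t' → c ≠ num t → c ≠ den t →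
    k = den t → num t' = num t ∧ den t' = c ∧
      h ⟨d t', t', rfl⟩ = ((d t (num t) : ℚ) + 1) / ((d t c : ℚ) + 1)

/-- The tree of the fractions `(d t a + 1) / (d t b + 1)` as written, that is, of the pairs
(numerator, denominator) before any cancellation. -/
def writtenFractionTree (d : T3' → Fin 3 → ℕ) (num den : T3' → Fin 3) :
    LabelledTree (ℕ × ℕ) where
  Vertex := T3'
  root := T3'.t1
  Edge := T3'.Edge
  val t := (d t (num t) + 1, d t (den t) + 1)

/-! ### The Calkin–Wilf tree -/

/-- The index different from `a` and `b`, for `a ≠ b`. -/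
def thirdLabel (a b : Fin 3) : Fin 3 := -(a + b)

theorem thirdLabel_ne (a b : Fin 3) (hab : a ≠ b) : thirdLabel a b ≠ a ∧ thirdLabel a b ≠ b := by
  revert a b
  decide

inductive Side where
  | left
  | right

/-- A fraction `x / y` in the Calkin–Wilf tree with the labels of the edges to its children. -/
structure CWNode where
  x : ℕ
  y : ℕ
  leftLabel : Fin 3
  rightLabel : Fin 3

/-- The children of `x / y` are `x / (x + y)` on the left and `(x + y) / y` on the right. If the
edges to them are labelled `a` and `b`, and `c` is the third label, then the edges from the left
child are labelled `c, b` and those from the right child `a, c` (left, right). -/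
def CWNode.child (n : CWNode) : Side → CWNode
  | .left => ⟨n.x, n.x + n.y, thirdLabel n.leftLabel n.rightLabel, n.rightLabel⟩
  | .right => ⟨n.x + n.y, n.y, n.leftLabel, thirdLabel n.leftLabel n.rightLabel⟩

/-- The node reached from the root `1 / 1` by a sequence of steps, the last one at the head.
The edge from `1 / 1` to `1 / 2` is labelled `2` and that to `2 / 1` is labelled `1`. -/
def cwNode : List Side → CWNode
  | [] => ⟨1, 1, 1, 0⟩
  | s :: p => (cwNode p).child s

/-- The label of the edge from a node to its child on the given side. -/
def CWNode.label (n : CWNode) : Side → Fin 3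
  | .left => n.leftLabel
  | .right => n.rightLabel

/-- The Calkin–Wilf tree; a fraction `x / y` is written as the pair `(x, y)`. -/
def calkinWilfTree : LabelledTree (ℕ × ℕ) where
  Vertex := List Side
  root := []
  Edge k p q := ∃ s : Side,
    (q = s :: p ∧ k = (cwNode p).label s) ∨ (p = s :: q ∧ k = (cwNode q).label s)
  val p := ((cwNode p).x, (cwNode p).y)

/-- The rational number given by a fraction. -/
def fractionValue (f : ℕ × ℕ) : ℚ := (f.1 : ℚ) / (f.2 : ℚ)

end PuncturedTorus

/-! Lifting to the plane turns arcs into lattice vectors. The endpoint of the lift determines the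
homotopy class of a loop. For a simple essential loop it is primitive (`IsLift.isCoprime`), so arcs
are primitive vectors up to sign (`arcOf_surjective`, `arcOf_eq_arcOf_iff`). Different arcs with
vectors u, v have intersection number |det(u, v)| - 1 (`intersectionNumber_arcOf`): a
Poincaré–Miranda argument bounds the crossings of all representatives from below, and segments
attain the bound. Both planar facts are proved with continuous angles.

The rest is arithmetic. A triangulation is a triple of vectors with pairwise determinants ±1. Over a
basis a, b the third vector is ±(a + b) or ±(a - b), and a flip exchanges these two options. Hence
flips are unique and can be propagated along the tree, which is (1). If A, B are the determinants of
a, b with ℓ₃, then |A| + |B| is one of |A + B| and |A - B|, so a flipped entry that is not the sum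
of the other two becomes that sum (`IsFlip.detAbs_eq_add`).

At `t1` the numbers d + 1 are (1, 1, 2). From then on the entry flipped last is the sum of the two
others, x and y, which form the fraction x/y. Flipping the entry x puts x + y in its place in the
fraction and gives (x + y)/y; flipping y gives x/(x + y). This is the Calkin–Wilf rule
(`IsAdditive.cwNode_sides`). The entry flipped last is the strict maximum, and the previous vector
can be recovered, so different vertices carry different vectors (`IsAdditive.injective`). This is
why h is well defined. -/

namespace PuncturedTorus

section Angles

open Real

/-! ### Angles of planar maps without zeros -/

/-- A continuous map from the plane to the plane without zeros has a continuous angle, with a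
prescribed value at a given point. -/
theorem exists_continuous_angle {X Y : ℝ × ℝ → ℝ} (hX : Continuous X) (hY : Continuous Y)
    (h : ∀ x, ¬ (X x = 0 ∧ Y x = 0)) (x₀ : ℝ × ℝ) {r₀ θ₀ : ℝ} (hr₀ : 0 < r₀)
    (hX₀ : X x₀ = r₀ * cos θ₀) (hY₀ : Y x₀ = r₀ * sin θ₀) :
    ∃ r θ : ℝ × ℝ → ℝ, Continuous θ ∧ θ x₀ = θ₀ ∧ (∀ x, 0 < r x) ∧
      (∀ x, X x = r x * cos (θ x)) ∧ ∀ x, Y x = r x * sin (θ x) := by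
  have hne : ∀ x, (⟨X x, Y x⟩ : ℂ) ≠ 0 := fun x hx =>
    h x ⟨congrArg Complex.re hx, congrArg Complex.im hx⟩
  have hcont : Continuous fun x => (⟨X x, Y x⟩ : ℂ) :=
    (Complex.equivRealProdCLM.symm.continuous).comp (hX.prodMk hY)
  let H : C(ℝ × ℝ, {z : ℂ // z ≠ 0}) := ⟨fun x => ⟨⟨X x, Y x⟩, hne x⟩, hcont.subtype_mk _⟩
  -- The map is lifted through the covering exp : ℂ → ℂ \ {0}; the imaginary part of the lift is the
  -- angle, and the base value log r₀ + iθ₀ prescribes it at `x₀`.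
  have hstart : (⟨_, Complex.exp_ne_zero (⟨log r₀, θ₀⟩ : ℂ)⟩ : {z : ℂ // z ≠ 0}) = H x₀ := by
    apply Subtype.ext
    apply Complex.ext
    · simp [H, Complex.exp_re, exp_log hr₀, hX₀]
    · simp [H, Complex.exp_im, exp_log hr₀, hY₀]
  obtain ⟨F, ⟨hF₀, hF⟩, -⟩ :=
    Complex.isCoveringMap_exp.existsUnique_continuousMap_lifts H x₀ ⟨log r₀, θ₀⟩ hstart
  have hF' : ∀ x, Complex.exp (F x) = ⟨X x, Y x⟩ := fun x =>
    congrArg Subtype.val (congrFun hF x)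
  refine ⟨fun x => exp (F x).re, fun x => (F x).im, by fun_prop, by simp [hF₀],
    fun x => exp_pos _, fun x => ?_, fun x => ?_⟩
  · rw [← Complex.exp_re, hF']
  · rw [← Complex.exp_im, hF']

/-- An angle that moves continuously in a half-plane does not leave the corresponding interval. -/
theorem angle_mem_Icc {θ : ℝ → ℝ} (hθ : Continuous θ) {α : ℝ} (h : ∀ s, 0 ≤ sin (θ s - α))
    {a : ℝ} (ha : θ a ∈ Set.Icc α (α + π)) (b : ℝ) : θ b ∈ Set.Icc α (α + π) := by
  have hconn : (Set.range θ).OrdConnected := (isPreconnected_range hθ).ordConnected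
  have key : ∀ y ∈ Set.range θ, 0 ≤ sin (y - α) := by
    rintro _ ⟨s, rfl⟩
    exact h s
  have hpi := pi_pos
  constructor
  · by_contra! hb
    -- By the intermediate value theorem an angle leaving the interval takes a value in (α - π, α),
    -- where the sine is negative; the cutoff at π/2 keeps the value within this half-period.
    have hm : max (θ b) (α - π / 2) ∈ Set.range θ :=
      hconn.out ⟨b, rfl⟩ ⟨a, rfl⟩ ⟨le_max_left _ _, max_le (hb.le.trans ha.1) (by linarith [ha.1])⟩
    have := key _ hm
    have hlt : sin (max (θ b) (α - π / 2) - α) < 0 := by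
      apply sin_neg_of_neg_of_neg_pi_lt
      · rcases max_cases (θ b) (α - π / 2) with ⟨h1, -⟩ | ⟨h1, -⟩ <;> rw [h1] <;> linarith
      · linarith [le_max_right (θ b) (α - π / 2)]
    linarith
  · by_contra! hb
    have hm : min (θ b) (α + π + π / 2) ∈ Set.range θ :=
      hconn.out ⟨a, rfl⟩ ⟨b, rfl⟩ ⟨le_min (ha.2.trans hb.le) (by linarith [ha.2]), min_le_left _ _⟩
    have := key _ hm
    have hlt : sin (min (θ b) (α + π + π / 2) - α) < 0 := by
      have : sin (min (θ b) (α + π + π / 2) - α) =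
          - sin (min (θ b) (α + π + π / 2) - α - π) := by rw [sin_sub_pi, neg_neg]
      rw [this, neg_lt_zero]
      apply sin_pos_of_pos_of_lt_pi
      · rcases min_cases (θ b) (α + π + π / 2) with ⟨h1, -⟩ | ⟨h1, -⟩ <;> rw [h1] <;> linarith
      · linarith [min_le_right (θ b) (α + π + π / 2)]
    linarith

/-- A planar map whose components have opposite signs on opposite sides of a square has a zero. -/
theorem exists_zero_of_opposite_signs {X Y : ℝ × ℝ → ℝ} (hX : Continuous X) (hY : Continuous Y)
    (R : ℝ) (hright : ∀ t, 0 ≤ X (R, t)) (hleft : ∀ t, X (-R, t) ≤ 0)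
    (htop : ∀ s, 0 ≤ Y (s, R)) (hbottom : ∀ s, Y (s, -R) ≤ 0) :
    ∃ x, X x = 0 ∧ Y x = 0 := by
  by_contra! hne
  have hpi := pi_pos
  -- Without a zero the angle is followed once around the square from this corner. The sign on each
  -- side confines it to a half-plane, so it starts at most 0 and returns to the same corner at
  -- least π.
  set z : ℂ := ⟨X (R, -R), Y (R, -R)⟩ with hz
  have hz0 : z ≠ 0 := fun h0 => hne (R, -R) (congrArg Complex.re h0) (congrArg Complex.im h0)
  have harg : |z.arg| ≤ π / 2 := Complex.abs_arg_le_pi_div_two_iff.2 (hright _)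
  have harg' : z.arg ≤ 0 := by
    by_contra! hpos
    have h1 : 0 ≤ z.im := Complex.arg_nonneg_iff.1 hpos.le
    have h2 : z.im = 0 := le_antisymm (hbottom R) h1
    have h3 : z.arg = 0 := Complex.arg_eq_zero_iff.2 ⟨hright _, h2⟩
    linarith
  obtain ⟨r, θ, hθ, hθ₀, hr, hXr, hYr⟩ :=
    exists_continuous_angle hX hY (fun x hx => hne x hx.1 hx.2) (R, -R) (norm_pos_iff.2 hz0)
      (θ₀ := z.arg) (by rw [Complex.norm_mul_cos_arg]) (by rw [Complex.norm_mul_sin_arg])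
  have hcos : ∀ x, 0 ≤ X x → 0 ≤ cos (θ x) := fun x hx =>
    nonneg_of_mul_nonneg_right (hXr x ▸ hx) (hr x)
  have hcos' : ∀ x, X x ≤ 0 → cos (θ x) ≤ 0 := fun x hx => by
    have := hXr x ▸ hx
    by_contra! h
    exact absurd this (not_le.2 (mul_pos (hr x) h))
  have hsin : ∀ x, 0 ≤ Y x → 0 ≤ sin (θ x) := fun x hx =>
    nonneg_of_mul_nonneg_right (hYr x ▸ hx) (hr x)
  have hsin' : ∀ x, Y x ≤ 0 → sin (θ x) ≤ 0 := fun x hx => by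
    have := hYr x ▸ hx
    by_contra! h
    exact absurd this (not_le.2 (mul_pos (hr x) h))
  have h1 := angle_mem_Icc (θ := fun t => θ (R, t)) (α := -(π / 2)) (by fun_prop)
    (fun t => by
      rw [sub_neg_eq_add, sin_add_pi_div_two]
      exact hcos _ (hright t)) (a := -R)
    (by
      rw [hθ₀]
      exact ⟨(abs_le.1 harg).1, by linarith⟩) R
  have h1' : 0 ≤ θ (R, R) := by
    by_contra! h
    linarith [sin_neg_of_neg_of_neg_pi_lt h (by linarith [h1.1]), hsin _ (htop R)]
  have h2 := angle_mem_Icc (θ := fun s => θ (s, R)) (α := 0) (by fun_prop)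
    (fun s => by
      rw [sub_zero]
      exact hsin _ (htop s)) (a := R) ⟨h1', by linarith [h1.2]⟩ (-R)
  have h2' : π / 2 ≤ θ (-R, R) := by
    by_contra! h
    linarith [cos_pos_of_mem_Ioo ⟨by linarith [h2.1], h⟩, hcos' _ (hleft R)]
  have h3 := angle_mem_Icc (θ := fun t => θ (-R, t)) (α := π / 2) (by fun_prop)
    (fun t => by
      rw [sin_sub_pi_div_two]
      linarith [hcos' _ (hleft t)]) (a := R) ⟨h2', by linarith [h2.2]⟩ (-R)
  have h3' : π ≤ θ (-R, -R) := by
    by_contra! h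
    linarith [sin_pos_of_pos_of_lt_pi (by linarith [h3.1]) h, hsin' _ (hbottom (-R))]
  have h4 := angle_mem_Icc (θ := fun s => θ (s, -R)) (α := π) (by fun_prop)
    (fun s => by
      rw [sin_sub_pi]
      linarith [hsin' _ (hbottom s)]) (a := -R) ⟨h3', by linarith [h3.2]⟩ R
  have h5 := h4.1
  rw [hθ₀] at h5
  linarith

/-- Let a planar curve `(x, y)` attain its least and its greatest height. If it has no horizontal
chords of the lengths `a` and `b`, it has none of the length `a + b`. -/
theorem no_horizontal_chord_add {x y : ℝ → ℝ} (hx : Continuous x) (hy : Continuous y)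
    {sₘ sₚ : ℝ} (hm : ∀ s, y sₘ ≤ y s) (hp : ∀ s, y s ≤ y sₚ) {a b : ℝ} (ha : 0 < a) (hb : 0 < b)
    (hna : ∀ s t, ¬ (x s - x t = a ∧ y s = y t)) (hnb : ∀ s t, ¬ (x s - x t = b ∧ y s = y t))
    (s t : ℝ) : ¬ (x s - x t = a + b ∧ y s = y t) := by
  rintro ⟨hxst, hyst⟩
  have hpi := pi_pos
  -- The missing chords make two difference maps on the plane of parameter pairs nonvanishing. On
  -- the diagonal they are the constant vectors (-a, 0) and (b, 0), with angles π and 0.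
  obtain ⟨r, θ, hθ, hθ₀, hr, hXr, hYr⟩ :=
    exists_continuous_angle (X := fun p => x p.1 - x p.2 - a) (Y := fun p => y p.1 - y p.2)
      (by fun_prop) (by fun_prop) (fun p hp => hna p.1 p.2 ⟨by linarith [hp.1], by linarith [hp.2]⟩)
      (sₘ, sₘ) (r₀ := a) (θ₀ := π) ha (by simp) (by simp)
  obtain ⟨ρ, φ, hφ, hφ₀, hρ, hXρ, hYρ⟩ :=
    exists_continuous_angle (X := fun p => x p.1 - x p.2 + b) (Y := fun p => y p.1 - y p.2)
      (by fun_prop) (by fun_prop) (fun p hp => hnb p.2 p.1 ⟨by linarith [hp.1], by linarith [hp.2]⟩)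
      (sₘ, sₘ) (r₀ := b) (θ₀ := 0) hb (by simp) (by simp)
  have sinθ : ∀ p, 0 ≤ y p.1 - y p.2 → 0 ≤ sin (θ p) := fun p hp =>
    nonneg_of_mul_nonneg_right (hYr p ▸ hp) (hr p)
  have sinθ' : ∀ p, 0 ≤ y p.2 - y p.1 → 0 ≤ sin (θ p - π) := fun p hp => by
    refine nonneg_of_mul_nonneg_right (a := r p) ?_ (hr p)
    rw [sin_sub_pi, mul_neg, ← hYr p]
    linarith
  have sinφ : ∀ p, 0 ≤ y p.1 - y p.2 → 0 ≤ sin (φ p) := fun p hp =>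
    nonneg_of_mul_nonneg_right (hYρ p ▸ hp) (hρ p)
  have sinφ' : ∀ p, 0 ≤ y p.2 - y p.1 → 0 ≤ sin (φ p - -π) := fun p hp => by
    refine nonneg_of_mul_nonneg_right (a := ρ p) ?_ (hρ p)
    rw [sub_neg_eq_add, sin_add_pi, mul_neg, ← hYρ p]
    linarith
  have diagθ : ∀ u, θ (u, u) = π := fun u => by
    have h1 := angle_mem_Icc (θ := fun u => θ (u, u)) (α := 0) (by fun_prop)
      (fun u => by simpa using sinθ (u, u) (by simp)) (a := sₘ) ⟨by linarith, by linarith⟩ u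
    have h2 := angle_mem_Icc (θ := fun u => θ (u, u)) (α := π) (by fun_prop)
      (fun u => sinθ' (u, u) (by simp)) (a := sₘ) ⟨by linarith, by linarith⟩ u
    linarith [h1.2, h2.1]
  have diagφ : ∀ u, φ (u, u) = 0 := fun u => by
    have h1 := angle_mem_Icc (θ := fun u => φ (u, u)) (α := 0) (by fun_prop)
      (fun u => by simpa using sinφ (u, u) (by simp)) (a := sₘ) ⟨by linarith, by linarith⟩ u
    have h2 := angle_mem_Icc (θ := fun u => φ (u, u)) (α := -π) (by fun_prop)
      (fun u => sinφ' (u, u) (by simp)) (a := sₘ) ⟨by linarith, by linarith⟩ u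
    linarith [h1.1, h2.2]
  have hθp := angle_mem_Icc (θ := fun u => θ (sₚ, u)) (α := 0) (by fun_prop)
    (fun u => by simpa using sinθ (sₚ, u) (by simpa using hp u)) (a := sₚ)
    (by simp [diagθ, hpi.le]) t
  have hθm := angle_mem_Icc (θ := fun u => θ (sₘ, u)) (α := π) (by fun_prop)
    (fun u => sinθ' (sₘ, u) (by simpa using hm u)) (a := sₘ)
    (by simp [diagθ, hpi.le]) t
  have hφp := angle_mem_Icc (θ := fun u => φ (sₚ, u)) (α := 0) (by fun_prop)
    (fun u => by simpa using sinφ (sₚ, u) (by simpa using hp u)) (a := sₚ)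
    (by simp [diagφ, hpi.le]) s
  have hφm := angle_mem_Icc (θ := fun u => φ (sₘ, u)) (α := -π) (by fun_prop)
    (fun u => sinφ' (sₘ, u) (by simpa using hm u)) (a := sₘ)
    (by simp [diagφ, hpi.le]) s
  -- A chord of length a + b makes the first map at (u, t) and the second at (u, s) the same vector
  -- for every u.
  have hX : ∀ u, r (u, t) * cos (θ (u, t)) = ρ (u, s) * cos (φ (u, s)) := fun u => by
    rw [← hXr, ← hXρ]
    simp only
    linarith
  have hY : ∀ u, r (u, t) * sin (θ (u, t)) = ρ (u, s) * sin (φ (u, s)) := fun u => by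
    rw [← hYr, ← hYρ]
    simp only
    linarith
  have hδ : ∀ u, sin (θ (u, t) - φ (u, s)) = 0 := fun u => by
    have : r (u, t) * ρ (u, s) * sin (θ (u, t) - φ (u, s)) = 0 := by
      rw [sin_sub]
      linear_combination (ρ (u, s) * cos (φ (u, s))) * hY u - (ρ (u, s) * sin (φ (u, s))) * hX u
    rcases mul_eq_zero.1 this with h | h
    · exact absurd h (mul_pos (hr _) (hρ _)).ne'
    · exact h
  have hδ' : ∀ u, sin (θ (u, t) - φ (u, s) - (θ (sₘ, t) - φ (sₘ, s))) = 0 := fun u => by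
    rw [sin_sub, hδ, hδ]
    ring
  -- The difference of angles has vanishing sine, so it is constant. It is at least π at the lowest
  -- point and at most π at the highest, which forces the angles π and 0 at the highest point: equal
  -- vectors would point in opposite directions.
  have h1 := angle_mem_Icc (θ := fun u => θ (u, t) - φ (u, s)) (by fun_prop)
    (fun u => (hδ' u).ge) (a := sₘ) ⟨le_rfl, by linarith⟩ sₚ
  have h2 := angle_mem_Icc (θ := fun u => θ (u, t) - φ (u, s))
    (α := θ (sₘ, t) - φ (sₘ, s) - π) (by fun_prop)
    (fun u => by
      have : θ (u, t) - φ (u, s) - (θ (sₘ, t) - φ (sₘ, s) - π) =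
        θ (u, t) - φ (u, s) - (θ (sₘ, t) - φ (sₘ, s)) + π := by ring
      rw [this, sin_add_pi, hδ', neg_zero]) (a := sₘ) ⟨by linarith, by linarith⟩ sₚ
  have hθpi : θ (sₚ, t) = π := by linarith [h1.1, h2.2, hθp.2, hθm.1, hφp.1, hφm.2]
  have hφzero : φ (sₚ, s) = 0 := by linarith [h1.1, h2.2, hθp.2, hθm.1, hφp.1, hφm.2]
  have := hX sₚ
  rw [hθpi, hφzero, cos_pi, cos_zero] at this
  linarith [hr (sₚ, t), hρ (sₚ, s)]

end Angles

open unitInterval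

/-! ### Lifts of loops to the plane -/

/-- The curve `(x, y)` in the plane lifts the loop `p`, starting at the origin and ending at the
lattice point `u`. -/
structure IsLift (p : Path puncture puncture) (x y : ℝ → ℝ) (u : ℤ × ℤ) : Prop where
  continuous_fst : Continuous x
  continuous_snd : Continuous y
  fst_zero : x 0 = 0
  snd_zero : y 0 = 0
  fst_one : x 1 = u.1
  snd_one : y 1 = u.2
  apply_eq : ∀ s : I, p s = ((x s : AddCircle (1 : ℝ)), (y s : AddCircle (1 : ℝ)))

theorem coe_eq_coe_iff_exists_int {a b : ℝ} :
    (a : AddCircle (1 : ℝ)) = (b : AddCircle (1 : ℝ)) ↔ ∃ n : ℤ, a - b = n := by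
  rw [← sub_eq_zero, ← AddCircle.coe_sub, AddCircle.coe_eq_zero_iff]
  simp [eq_comm]

theorem exists_circle_lift (q : C(I, AddCircle (1 : ℝ))) (h0 : q 0 = 0) (h1 : q 1 = 0) :
    ∃ x : ℝ → ℝ, Continuous x ∧ x 0 = 0 ∧ (∃ n : ℤ, x 1 = n) ∧ ∀ s : I, q s = x s := by
  obtain ⟨Γ, hΓ, hΓ0⟩ := (AddCircle.isCoveringMap_coe (1 : ℝ)).exists_path_lifts q 0 (by simp [h0])
  have hq : ∀ s : I, q s = (Γ s : AddCircle (1 : ℝ)) := fun s => (congrFun hΓ s).symm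
  refine ⟨Set.IccExtend zero_le_one Γ, Γ.continuous.Icc_extend', ?_, ?_, fun s => ?_⟩
  · rw [Set.IccExtend_left]
    exact hΓ0
  · rw [Set.IccExtend_right]
    have := hq 1
    rw [h1, eq_comm, AddCircle.coe_eq_zero_iff] at this
    obtain ⟨n, hn⟩ := this
    exact ⟨n, by simpa using hn.symm⟩
  · rw [Set.IccExtend_val, hq]

theorem exists_isLift (p : Path puncture puncture) : ∃ x y u, IsLift p x y u := by
  obtain ⟨x, hx, hx0, ⟨m, hm⟩, hpx⟩ := exists_circle_lift
    ⟨fun s => (p s).1, by fun_prop⟩ (congrArg Prod.fst p.source) (congrArg Prod.fst p.target)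
  obtain ⟨y, hy, hy0, ⟨n, hn⟩, hpy⟩ := exists_circle_lift
    ⟨fun s => (p s).2, by fun_prop⟩ (congrArg Prod.snd p.source) (congrArg Prod.snd p.target)
  exact ⟨x, y, (m, n), hx, hy, hx0, hy0, hm, hn, fun s => Prod.ext (hpx s) (hpy s)⟩

theorem circle_lift_one_eq {q q' : C(I, AddCircle (1 : ℝ))} (h : q.HomotopicRel q' {0, 1})
    {x x' : ℝ → ℝ} (hx : Continuous x) (hx' : Continuous x') (hx0 : x 0 = 0) (hx'0 : x' 0 = 0)
    (hq : ∀ s : I, q s = x s) (hq' : ∀ s : I, q' s = x' s) : x 1 = x' 1 := by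
  have cov := AddCircle.isCoveringMap_coe (1 : ℝ)
  have h0 : q 0 = ((0 : ℝ) : AddCircle (1 : ℝ)) := by simpa [hx0] using hq 0
  have h0' : q' 0 = ((0 : ℝ) : AddCircle (1 : ℝ)) := by simpa [hx'0] using hq' 0
  have e := (cov.eq_liftPath_iff h0 (Γ := fun s : I => x s)).2
    ⟨by fun_prop, funext fun s => (hq s).symm, by simpa using hx0⟩
  have e' := (cov.eq_liftPath_iff h0' (Γ := fun s : I => x' s)).2
    ⟨by fun_prop, funext fun s => (hq' s).symm, by simpa using hx'0⟩
  have h1 := congrFun e 1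
  have h1' := congrFun e' 1
  simp only [Set.Icc.coe_one] at h1 h1'
  rw [h1, h1']
  exact cov.liftPath_apply_one_eq_of_homotopicRel h 0 h0 h0'

theorem IsLift.eq_of_homotopic {p q : Path puncture puncture} {x y x' y' : ℝ → ℝ} {u u' : ℤ × ℤ}
    (hp : IsLift p x y u) (hq : IsLift q x' y' u') (h : p.Homotopic q) : u = u' := by
  have h1 := ContinuousMap.HomotopicRel.comp_continuousMap h
    (⟨Prod.fst, _root_.continuous_fst⟩ : C(Torus, AddCircle (1 : ℝ)))
  have h2 := ContinuousMap.HomotopicRel.comp_continuousMap h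
    (⟨Prod.snd, _root_.continuous_snd⟩ : C(Torus, AddCircle (1 : ℝ)))
  have e1 := circle_lift_one_eq h1 hp.continuous_fst hq.continuous_fst hp.fst_zero hq.fst_zero
    (fun s => congrArg Prod.fst (hp.apply_eq s)) (fun s => congrArg Prod.fst (hq.apply_eq s))
  have e2 := circle_lift_one_eq h2 hp.continuous_snd hq.continuous_snd hp.snd_zero hq.snd_zero
    (fun s => congrArg Prod.snd (hp.apply_eq s)) (fun s => congrArg Prod.snd (hq.apply_eq s))
  rw [hp.fst_one, hq.fst_one] at e1
  rw [hp.snd_one, hq.snd_one] at e2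
  exact Prod.ext (by exact_mod_cast e1) (by exact_mod_cast e2)

/-- The straight-line homotopy between the lifts fixes both endpoints and descends to the torus. -/
theorem IsLift.homotopic {p q : Path puncture puncture} {x y x' y' : ℝ → ℝ} {u : ℤ × ℤ}
    (hp : IsLift p x y u) (hq : IsLift q x' y' u) : p.Homotopic q := by
  have := hp.continuous_fst
  have := hp.continuous_snd
  have := hq.continuous_fst
  have := hq.continuous_snd
  let π : ℝ × ℝ → Torus := fun z => ((z.1 : AddCircle (1 : ℝ)), (z.2 : AddCircle (1 : ℝ)))
  have hπ : Continuous π :=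
    ((AddCircle.continuous_mk' 1).comp _root_.continuous_fst).prodMk
      ((AddCircle.continuous_mk' 1).comp _root_.continuous_snd)
  refine ⟨⟨⟨⟨fun z => π ((1 - z.1) * x z.2 + z.1 * x' z.2, (1 - z.1) * y z.2 + z.1 * y' z.2),
    hπ.comp (by fun_prop)⟩, fun s => ?_, fun s => ?_⟩, fun t s hs => ?_⟩⟩
  · simpa [π] using (hp.apply_eq s).symm
  · simpa [π] using (hq.apply_eq s).symm
  · rcases hs with rfl | hs
    · simp [π, hp.fst_zero, hp.snd_zero, hq.fst_zero, hq.snd_zero]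
      rfl
    · rw [Set.mem_singleton_iff] at hs
      subst hs
      have h1 := hp.apply_eq 1
      simp only [Set.Icc.coe_one, hp.fst_one, hp.snd_one] at h1
      simp only [ContinuousMap.coe_mk, π, Set.Icc.coe_one, hp.fst_one, hp.snd_one, hq.fst_one,
        hq.snd_one]
      rw [← add_mul, ← add_mul]
      simpa using h1.symm

theorem IsLift.symm {p : Path puncture puncture} {x y : ℝ → ℝ} {u : ℤ × ℤ} (hp : IsLift p x y u) :
    IsLift p.symm (fun s => x (1 - s) - u.1) (fun s => y (1 - s) - u.2) (-u) where
  continuous_fst := by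
    have := hp.continuous_fst
    fun_prop
  continuous_snd := by
    have := hp.continuous_snd
    fun_prop
  fst_zero := by simp [hp.fst_one]
  snd_zero := by simp [hp.snd_one]
  fst_one := by simp [hp.fst_zero]
  snd_one := by simp [hp.snd_zero]
  apply_eq s := by
    rw [Path.symm_apply, Function.comp_apply, hp.apply_eq]
    refine Prod.ext ?_ ?_
    · exact coe_eq_coe_iff_exists_int.2 ⟨u.1, by simp⟩
    · exact coe_eq_coe_iff_exists_int.2 ⟨u.2, by simp⟩

theorem isLift_refl : IsLift (Path.refl puncture) (fun _ => 0) (fun _ => 0) 0 where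
  continuous_fst := continuous_const
  continuous_snd := continuous_const
  fst_zero := rfl
  snd_zero := rfl
  fst_one := by simp
  snd_one := by simp
  apply_eq _ := rfl

/-! ### Endpoints of lifts of simple essential loops -/

theorem IsLift.ne_zero {γ : ArcCurve} {x y : ℝ → ℝ} {u : ℤ × ℤ} (h : IsLift γ.path x y u) :
    u ≠ 0 := by
  rintro rfl
  exact γ.essential (h.homotopic isLift_refl)

/-- A lift of an arc curve meets no lattice translate of itself except at the endpoints. -/
theorem IsLift.eq_or_of_sub_mem_lattice {γ : ArcCurve} {x y : ℝ → ℝ} {u : ℤ × ℤ}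
    (h : IsLift γ.path x y u) {s t : I} {m n : ℤ} (hx : x s - x t = m) (hy : y s - y t = n) :
    s = t ∨ (s = 0 ∧ t = 1) ∨ (s = 1 ∧ t = 0) := by
  apply γ.simple
  rw [h.apply_eq, h.apply_eq]
  exact Prod.ext (coe_eq_coe_iff_exists_int.2 ⟨m, hx⟩) (coe_eq_coe_iff_exists_int.2 ⟨n, hy⟩)

/-- A simple essential loop ends at a primitive lattice point. -/
theorem IsLift.isCoprime {γ : ArcCurve} {x y : ℝ → ℝ} {u : ℤ × ℤ} (h : IsLift γ.path x y u) :
    IsCoprime u.1 u.2 := by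
  have hx := h.continuous_fst
  have hy := h.continuous_snd
  by_contra hu
  have hgpos : 0 < Int.gcd u.1 u.2 := by
    rw [Int.gcd_pos_iff]
    by_contra! h0
    exact h.ne_zero (Prod.ext h0.1 h0.2)
  obtain ⟨g, hg⟩ : ∃ g, Int.gcd u.1 u.2 = g := ⟨_, rfl⟩
  have hg2 : g ≠ 1 := fun h1 => hu (Int.isCoprime_iff_gcd_eq_one.2 (hg.trans h1))
  obtain ⟨a, ha⟩ : (g : ℤ) ∣ u.1 := hg ▸ Int.gcd_dvd_left ..
  obtain ⟨b, hb⟩ : (g : ℤ) ∣ u.2 := hg ▸ Int.gcd_dvd_right ..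
  rw [hg] at hgpos
  have hab : (0 : ℝ) < a ^ 2 + b ^ 2 := by
    by_contra! hle
    have h1 : (a : ℝ) = 0 := by nlinarith [sq_nonneg (a : ℝ), sq_nonneg (b : ℝ)]
    have h2 : (b : ℝ) = 0 := by nlinarith [sq_nonneg (a : ℝ), sq_nonneg (b : ℝ)]
    have h1' : a = 0 := by exact_mod_cast h1
    have h2' : b = 0 := by exact_mod_cast h2
    exact h.ne_zero (Prod.ext (by simp [ha, h1']) (by simp [hb, h2']))
  let c : ℝ → I := Set.projIcc 0 1 zero_le_one
  have hc : Continuous c := continuous_projIcc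
  -- With u = g(a, b), these are coordinates along and across (a, b), the former in units of (a, b):
  -- a horizontal chord of length l joins points that differ by l(a, b).
  let X : ℝ → ℝ := fun s => (x (c s) * a + y (c s) * b) / (a ^ 2 + b ^ 2)
  let Y : ℝ → ℝ := fun s => a * y (c s) - b * x (c s)
  have hXc : Continuous X := by fun_prop
  have hYc : Continuous Y := by fun_prop
  have hYI : Continuous fun s : I => a * y s - b * x s := by fun_prop
  obtain ⟨sₘ, -, hm⟩ := isCompact_univ.exists_isMinOn Set.univ_nonempty hYI.continuousOn
  obtain ⟨sₚ, -, hp⟩ := isCompact_univ.exists_isMaxOn Set.univ_nonempty hYI.continuousOn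
  have hcI : ∀ s : I, c s = s := fun s => Set.projIcc_val zero_le_one s
  have chord : ∀ (s t : ℝ) (l : ℝ), X s - X t = l → Y s = Y t →
      x (c s) - x (c t) = l * a ∧ y (c s) - y (c t) = l * b := by
    intro s t l h1 h2
    simp only [X, Y] at h1 h2
    rw [← sub_div, div_eq_iff hab.ne'] at h1
    constructor
    · apply mul_right_cancel₀ hab.ne'
      linear_combination a * h1 - b * h2
    · apply mul_right_cancel₀ hab.ne'
      linear_combination b * h1 + a * h2
  have hne : ∀ k : ℤ, g * k ≠ 1 := fun k hk => by
    have := Int.eq_one_or_neg_one_of_mul_eq_one hk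
    omega
  -- Simplicity lets only the endpoints of the lift differ by a nonzero lattice vector, namely by
  -- ±g(a, b), and g ≠ 1.
  have hbase : ∀ s t, ¬ (X s - X t = 1 ∧ Y s = Y t) := by
    rintro s t ⟨h1, h2⟩
    obtain ⟨h3, h4⟩ := chord s t 1 h1 h2
    rw [one_mul] at h3 h4
    have key : ∃ k : ℤ, x (c s) - x (c t) = k * (g * a) ∧ y (c s) - y (c t) = k * (g * b) := by
      have ha' : (u.1 : ℝ) = g * a := by exact_mod_cast ha
      have hb' : (u.2 : ℝ) = g * b := by exact_mod_cast hb
      rcases h.eq_or_of_sub_mem_lattice h3 h4 with h5 | ⟨h5, h6⟩ | ⟨h5, h6⟩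
      · exact ⟨0, by simp [h5], by simp [h5]⟩
      · exact ⟨-1, by simp [h5, h6, h.fst_zero, h.fst_one, ha'],
          by simp [h5, h6, h.snd_zero, h.snd_one, hb']⟩
      · exact ⟨1, by simp [h5, h6, h.fst_zero, h.fst_one, ha'],
          by simp [h5, h6, h.snd_zero, h.snd_one, hb']⟩
    obtain ⟨k, h5, h6⟩ := key
    rw [h3] at h5
    rw [h4] at h6
    have h7 : ((g : ℝ) * k - 1) * (a ^ 2 + b ^ 2) = 0 := by
      linear_combination -a * h5 - b * h6
    rcases mul_eq_zero.1 h7 with h8 | h8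
    · exact hne k (by exact_mod_cast sub_eq_zero.1 h8)
    · exact hab.ne' h8
  have hall : ∀ k : ℕ, ∀ s t, ¬ (X s - X t = (k + 1 : ℕ) ∧ Y s = Y t) := by
    intro k
    induction k with
    | zero => simpa using hbase
    | succ k ih =>
      intro s t
      have := no_horizontal_chord_add hXc hYc (sₘ := sₘ) (sₚ := sₚ)
        (fun s => by simpa [Y, hcI] using hm (Set.mem_univ (c s)))
        (fun s => by simpa [Y, hcI] using hp (Set.mem_univ (c s)))
        (by positivity) zero_lt_one ih hbase s t
      simpa using this
  obtain ⟨k, rfl⟩ : ∃ k, g = k + 1 := ⟨g - 1, by omega⟩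
  have hc0 : c 0 = 0 := hcI 0
  have hc1 : c 1 = 1 := hcI 1
  -- The endpoints themselves form a horizontal chord of length g, although no positive integer
  -- length is possible.
  refine hall k 1 0 ⟨?_, ?_⟩
  · simp only [X, hc0, hc1, Set.Icc.coe_zero, Set.Icc.coe_one, h.fst_one, h.snd_one,
      h.fst_zero, h.snd_zero]
    rw [← sub_div, div_eq_iff hab.ne', ha, hb]
    push_cast
    ring
  · simp only [Y, hc0, hc1, Set.Icc.coe_zero, Set.Icc.coe_one, h.fst_one, h.snd_one,
      h.fst_zero, h.snd_zero]
    rw [ha, hb]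
    push_cast
    ring

/-! ### Straight arcs -/

/-- The primitive lattice vectors. -/
abbrev PrimitiveVector : Type := {u : ℤ × ℤ // IsCoprime u.1 u.2}

/-- The image in the torus of the segment from the origin to a lattice point. -/
noncomputable def segmentPath (u : ℤ × ℤ) : Path puncture puncture where
  toFun s := (((s * u.1 : ℝ) : AddCircle (1 : ℝ)), ((s * u.2 : ℝ) : AddCircle (1 : ℝ)))
  continuous_toFun :=
    ((AddCircle.continuous_mk' 1).comp (by fun_prop)).prodMk
      ((AddCircle.continuous_mk' 1).comp (by fun_prop))
  source' := by simp [puncture]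
  target' := by
    refine Prod.ext ?_ ?_
    · exact coe_eq_coe_iff_exists_int.2 ⟨u.1, by simp⟩
    · exact coe_eq_coe_iff_exists_int.2 ⟨u.2, by simp⟩

theorem isLift_segmentPath (u : ℤ × ℤ) :
    IsLift (segmentPath u) (fun s => s * u.1) (fun s => s * u.2) u where
  continuous_fst := by fun_prop
  continuous_snd := by fun_prop
  fst_zero := by simp
  snd_zero := by simp
  fst_one := by simp
  snd_one := by simp
  apply_eq _ := rfl

/-- The straight arc curve in the direction of a primitive vector. -/
noncomputable def straightCurve (u : PrimitiveVector) : ArcCurve where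
  path := segmentPath u.1
  simple s t hst := by
    obtain ⟨m, hm⟩ := coe_eq_coe_iff_exists_int.1 (congrArg Prod.fst hst)
    obtain ⟨n, hn⟩ := coe_eq_coe_iff_exists_int.1 (congrArg Prod.snd hst)
    obtain ⟨a, b, hab⟩ := u.2
    have hab' : (a : ℝ) * u.1.1 + b * u.1.2 = 1 := by exact_mod_cast hab
    have hk : (s : ℝ) - t = (a * m + b * n : ℤ) := by
      push_cast
      linear_combination a * hm + b * hn - (s - t : ℝ) * hab'
    generalize a * m + b * n = k at hk
    have hs := s.2
    have ht := t.2
    have h1 : (-1 : ℝ) ≤ k := by rw [← hk]; linarith [hs.1, ht.2]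
    have h2 : (k : ℝ) ≤ 1 := by rw [← hk]; linarith [hs.2, ht.1]
    have h1' : -1 ≤ k := by exact_mod_cast h1
    have h2' : k ≤ 1 := by exact_mod_cast h2
    obtain rfl | rfl | rfl : k = -1 ∨ k = 0 ∨ k = 1 := by omega
    · push_cast at hk
      have h0 : (s : ℝ) = 0 := by linarith [hs.1, ht.2]
      have h1 : (t : ℝ) = 1 := by linarith [hs.1, ht.2]
      exact Or.inr (Or.inl ⟨Subtype.ext h0, Subtype.ext h1⟩)
    · push_cast at hk
      exact Or.inl (Subtype.ext (by linarith))
    · push_cast at hk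
      have h0 : (s : ℝ) = 1 := by linarith [hs.2, ht.1]
      have h1 : (t : ℝ) = 0 := by linarith [hs.2, ht.1]
      exact Or.inr (Or.inr ⟨Subtype.ext h0, Subtype.ext h1⟩)
  essential h := by
    have h0 := (isLift_segmentPath u.1).eq_of_homotopic isLift_refl h
    have := u.2
    rw [h0] at this
    exact not_isCoprime_zero_zero this

/-- The arc of a primitive vector. -/
noncomputable def arcOf (u : PrimitiveVector) : Arc := (straightCurve u).arc

theorem isLift_straightCurve (u : PrimitiveVector) :
    IsLift (straightCurve u).path (fun s => s * u.1.1) (fun s => s * u.1.2) u.1 :=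
  isLift_segmentPath u.1

theorem arc_eq_arc_iff {γ δ : ArcCurve} {x y x' y' : ℝ → ℝ} {u v : ℤ × ℤ}
    (hγ : IsLift γ.path x y u) (hδ : IsLift δ.path x' y' v) :
    γ.arc = δ.arc ↔ u = v ∨ u = -v := by
  constructor
  · intro h
    rcases Quotient.exact h with h | h
    · exact Or.inl (hγ.eq_of_homotopic hδ h)
    · exact Or.inr (hγ.eq_of_homotopic hδ.symm h)
  · rintro (rfl | rfl)
    · exact Quotient.sound (Or.inl (hγ.homotopic hδ))
    · exact Quotient.sound (Or.inr (hγ.homotopic hδ.symm))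

theorem arcOf_eq_arcOf_iff {u v : PrimitiveVector} :
    arcOf u = arcOf v ↔ u.1 = v.1 ∨ u.1 = -v.1 :=
  arc_eq_arc_iff (isLift_straightCurve u) (isLift_straightCurve v)

theorem arcOf_surjective : Function.Surjective arcOf := by
  intro α
  obtain ⟨γ, rfl⟩ := Quotient.exists_rep α
  obtain ⟨x, y, u, h⟩ := exists_isLift γ.path
  exact ⟨⟨u, h.isCoprime⟩, (arc_eq_arc_iff (isLift_straightCurve _) h).2 (Or.inl rfl)⟩

/-! ### Intersection numbers -/

/-- The determinant of two lattice vectors. -/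
def det (u v : ℤ × ℤ) : ℤ := u.1 * v.2 - u.2 * v.1

/-- The deviation of a lift from its chord vanishes at both ends, so its 1-periodic extension has no
jumps. -/
theorem continuous_comp_fract_sub {x : ℝ → ℝ} (hx : Continuous x) (h0 : x 0 = 0) :
    Continuous fun s => x (Int.fract s) - Int.fract s * x 1 :=
  ContinuousOn.comp_fract'' (f := fun s => x s - s * x 1) (by fun_prop) (by simp [h0])

/-- The lattice translates of the periodic extensions of two lifted curves with independent
directions meet. -/
theorem exists_crossing_mod_lattice {p q : Path puncture puncture} {x y x' y' : ℝ → ℝ}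
    {u v : ℤ × ℤ} (hp : IsLift p x y u) (hq : IsLift q x' y' v) (hD : det u v ≠ 0) (w : ℤ × ℤ) :
    ∃ s ∈ Set.Ico (0 : ℝ) 1, ∃ t ∈ Set.Ico (0 : ℝ) 1, ∃ m n : ℤ,
      x s - x' t = (w.1 - m * u.1 + n * v.1 : ℤ) ∧ y s - y' t = (w.2 - m * u.2 + n * v.2 : ℤ) := by
  have hx := hp.continuous_fst
  have hy := hp.continuous_snd
  have hx' := hq.continuous_fst
  have hy' := hq.continuous_snd
  obtain ⟨D, hDdef⟩ : ∃ D : ℝ, D = u.1 * v.2 - u.2 * v.1 := ⟨_, rfl⟩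
  have hD0 : D ≠ 0 := by
    rw [hDdef]
    exact_mod_cast hD
  let α : ℝ → ℝ := fun s => x s - s * x 1
  let β : ℝ → ℝ := fun s => y s - s * y 1
  let α' : ℝ → ℝ := fun s => x' s - s * x' 1
  let β' : ℝ → ℝ := fun s => y' s - s * y' 1
  have hα : Continuous fun s => α (Int.fract s) := continuous_comp_fract_sub hx hp.fst_zero
  have hβ : Continuous fun s => β (Int.fract s) := continuous_comp_fract_sub hy hp.snd_zero
  have hα' : Continuous fun s => α' (Int.fract s) := continuous_comp_fract_sub hx' hq.fst_zero
  have hβ' : Continuous fun s => β' (Int.fract s) := continuous_comp_fract_sub hy' hq.snd_zero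
  -- The equation to be solved is su - tv + A = 0, with A the bounded periodic deviation minus w.
  -- Its determinants with v and u decouple the unknowns: Ds + E = 0 and Dt + F = 0.
  let E : ℝ × ℝ → ℝ := fun z =>
    (α z.1 - α' z.2 - w.1) * v.2 - (β z.1 - β' z.2 - w.2) * v.1
  let F : ℝ × ℝ → ℝ := fun z =>
    (α z.1 - α' z.2 - w.1) * u.2 - (β z.1 - β' z.2 - w.2) * u.1
  have hcompact : IsCompact (Set.Icc (0 : ℝ) 1 ×ˢ Set.Icc (0 : ℝ) 1) :=
    isCompact_Icc.prod isCompact_Icc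
  obtain ⟨K, hK⟩ := hcompact.exists_bound_of_continuousOn (f := E) (by fun_prop)
  obtain ⟨K', hK'⟩ := hcompact.exists_bound_of_continuousOn (f := F) (by fun_prop)
  have hmem : ∀ s t : ℝ, (Int.fract s, Int.fract t) ∈ Set.Icc (0 : ℝ) 1 ×ˢ Set.Icc (0 : ℝ) 1 :=
    fun s t => ⟨⟨Int.fract_nonneg s, (Int.fract_lt_one s).le⟩,
      ⟨Int.fract_nonneg t, (Int.fract_lt_one t).le⟩⟩
  obtain ⟨R, hR⟩ : ∃ R, R = max K K' / |D| := ⟨_, rfl⟩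
  have hRD : D * D * R = |D| * max K K' := by
    rw [hR, ← abs_mul_abs_self D]
    field_simp
  have hDK : ∀ e : ℝ, |e| ≤ max K K' → |D * e| ≤ D * D * R := fun e he => by
    rw [hRD, abs_mul]
    exact mul_le_mul_of_nonneg_left he (abs_nonneg D)
  have hE : ∀ s t : ℝ, |D * E (Int.fract s, Int.fract t)| ≤ D * D * R := fun s t =>
    hDK _ ((hK _ (hmem s t)).trans (le_max_left _ _))
  have hF : ∀ s t : ℝ, |D * F (Int.fract s, Int.fract t)| ≤ D * D * R := fun s t =>
    hDK _ ((hK' _ (hmem s t)).trans (le_max_right _ _))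
  have hA : Continuous fun z : ℝ × ℝ => α (Int.fract z.1) - α' (Int.fract z.2) - w.1 :=
    ((hα.comp continuous_fst).sub (hα'.comp continuous_snd)).sub continuous_const
  have hB : Continuous fun z : ℝ × ℝ => β (Int.fract z.1) - β' (Int.fract z.2) - w.2 :=
    ((hβ.comp continuous_fst).sub (hβ'.comp continuous_snd)).sub continuous_const
  have hEc : Continuous fun z : ℝ × ℝ => E (Int.fract z.1, Int.fract z.2) :=
    (hA.mul continuous_const).sub (hB.mul continuous_const)
  have hFc : Continuous fun z : ℝ × ℝ => F (Int.fract z.1, Int.fract z.2) :=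
    (hA.mul continuous_const).sub (hB.mul continuous_const)
  -- Multiplying by D makes the leading coefficients positive whatever its sign; on the square of
  -- half-width R they dominate the bounded terms.
  obtain ⟨⟨s, t⟩, h1, h2⟩ := exists_zero_of_opposite_signs
    (X := fun z => D * D * z.1 + D * E (Int.fract z.1, Int.fract z.2))
    (Y := fun z => D * D * z.2 + D * F (Int.fract z.1, Int.fract z.2))
    ((continuous_const.mul continuous_fst).add (continuous_const.mul hEc))
    ((continuous_const.mul continuous_snd).add (continuous_const.mul hFc))
    R
    (fun t => by linarith [(abs_le.1 (hE R t)).1]) (fun t => by linarith [(abs_le.1 (hE (-R) t)).2])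
    (fun s => by linarith [(abs_le.1 (hF s R)).1]) (fun s => by linarith [(abs_le.1 (hF s (-R))).2])
  refine ⟨Int.fract s, ⟨Int.fract_nonneg s, Int.fract_lt_one s⟩, Int.fract t,
    ⟨Int.fract_nonneg t, Int.fract_lt_one t⟩, ⌊s⌋, ⌊t⌋, ?_⟩
  have h1' : D * s + E (Int.fract s, Int.fract t) = 0 := by
    apply mul_left_cancel₀ hD0
    linear_combination h1
  have h2' : D * t + F (Int.fract s, Int.fract t) = 0 := by
    apply mul_left_cancel₀ hD0
    linear_combination h2
  simp only [E, F, α, β, α', β', hp.fst_one, hp.snd_one, hq.fst_one, hq.snd_one] at h1' h2'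
  have hs := Int.floor_add_fract s
  have ht := Int.floor_add_fract t
  push_cast
  constructor
  · apply mul_left_cancel₀ hD0
    subst hDdef
    linear_combination u.1 * h1' - v.1 * h2' + (u.1 * v.2 - u.2 * v.1) * (u.1 * hs - v.1 * ht)
  · apply mul_left_cancel₀ hD0
    subst hDdef
    linear_combination u.2 * h1' - v.2 * h2' + (u.1 * v.2 - u.2 * v.1) * (u.2 * hs - v.2 * ht)

theorem encard_Ioo_zero_abs (d : ℤ) : (Set.Ioo 0 |d|).encard = ((d.natAbs - 1 : ℕ) : ℕ∞) := by
  rw [← Finset.coe_Ioo, Set.encard_coe_eq_coe_finsetCard, Int.card_Ioo, Int.abs_eq_natAbs]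
  congr 1
  omega

/-- Two arc curves with independent directions `u` and `v` have at least `|det u v| - 1`
crossings. -/
theorem le_encard_crossings {γ δ : ArcCurve} {x y x' y' : ℝ → ℝ} {u v : ℤ × ℤ}
    (hγ : IsLift γ.path x y u) (hδ : IsLift δ.path x' y' v) (hD : det u v ≠ 0) :
    (((det u v).natAbs - 1 : ℕ) : ℕ∞) ≤ (γ.crossings δ).encard := by
  obtain ⟨b, a, hab⟩ := hγ.isCoprime
  -- The translation vector w is chosen with det(u, w) = j. Thus two choices of j with the same pair
  -- of parameters are congruent modulo det(u, v), and the puncture occurs only for j divisible by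
  -- it.
  have key := fun j : ℤ => exists_crossing_mod_lattice hγ hδ hD (-j * a, j * b)
  choose s hs t ht m n hx hy using key
  have hdvd : ∀ j j', s j = s j' → t j = t j' → det u v ∣ j - j' := by
    intro j j' h1 h2
    have e1 := (hx j).symm.trans (by rw [h1, h2, hx j'])
    have e2 := (hy j).symm.trans (by rw [h1, h2, hy j'])
    have e1' := Int.cast_injective e1
    have e2' := Int.cast_injective e2
    refine ⟨n j' - n j, ?_⟩
    simp only [det] at *
    linear_combination (-(j - j')) * hab - u.2 * e1' + u.1 * e2'
  let pt : ℤ → I := fun j => ⟨s j, (hs j).1, (hs j).2.le⟩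
  let qt : ℤ → I := fun j => ⟨t j, (ht j).1, (ht j).2.le⟩
  have hpq : ∀ j, γ.path (pt j) = δ.path (qt j) := fun j => by
    rw [hγ.apply_eq, hδ.apply_eq]
    exact Prod.ext (coe_eq_coe_iff_exists_int.2 ⟨_, hx j⟩) (coe_eq_coe_iff_exists_int.2 ⟨_, hy j⟩)
  have hp1 : ∀ j, pt j ≠ 1 := fun j h => (hs j).2.ne (congrArg Subtype.val h)
  have hq1 : ∀ j, qt j ≠ 1 := fun j h => (ht j).2.ne (congrArg Subtype.val h)
  have hsimple : ∀ (ε : ArcCurve) (a b : I), a ≠ 1 → b ≠ 1 → ε.path a = ε.path b → a = b := by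
    intro ε a b ha hb h
    rcases ε.simple a b h with h | h | h
    · exact h
    · exact absurd h.2 hb
    · exact absurd h.1 ha
  rw [← encard_Ioo_zero_abs]
  refine Set.encard_le_encard_of_injOn (f := fun j => γ.path (pt j)) ?_ ?_
  · intro j hj
    refine ⟨⟨⟨_, rfl⟩, ⟨_, (hpq j).symm⟩⟩, fun h => ?_⟩
    have h' : γ.path (pt j) = puncture := h
    have h1 : pt j = 0 := hsimple γ _ _ (hp1 j) zero_ne_one (h'.trans γ.path.source.symm)
    have h2 : qt j = 0 :=
      hsimple δ _ _ (hq1 j) zero_ne_one ((hpq j).symm.trans (h'.trans δ.path.source.symm))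
    have h1' : s j = 0 := congrArg Subtype.val h1
    have h2' : t j = 0 := congrArg Subtype.val h2
    have e1 := hx j
    have e2 := hy j
    rw [h1', h2', hγ.fst_zero, hδ.fst_zero, sub_zero] at e1
    rw [h1', h2', hγ.snd_zero, hδ.snd_zero, sub_zero] at e2
    have e1' : 0 = -j * a - m j * u.1 + n j * v.1 := by exact_mod_cast e1
    have e2' : 0 = j * b - m j * u.2 + n j * v.2 := by exact_mod_cast e2
    have hd : |det u v| ∣ j := by
      rw [abs_dvd]
      refine ⟨-n j, ?_⟩
      simp only [det]
      linear_combination (-j) * hab + u.2 * e1' - u.1 * e2'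
    exact absurd (Int.le_of_dvd hj.1 hd) (not_le.2 hj.2)
  · intro j hj j' hj' h
    have h1 : pt j = pt j' := hsimple γ _ _ (hp1 j) (hp1 j') h
    have h2 : qt j = qt j' :=
      hsimple δ _ _ (hq1 j) (hq1 j') ((hpq j).symm.trans (h.trans (hpq j')))
    have hd : |det u v| ∣ j - j' :=
      (abs_dvd _ _).2 (hdvd j j' (congrArg Subtype.val h1) (congrArg Subtype.val h2))
    have := Int.eq_zero_of_abs_lt_dvd hd
      (by rw [abs_lt]; constructor <;> linarith [hj.1, hj.2, hj'.1, hj'.2])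
    omega

/-- Straight curves with independent directions `u` and `v` have at most `|det u v| - 1`
crossings. -/
theorem encard_crossings_straightCurve_le (u v : PrimitiveVector) (hD : det u.1 v.1 ≠ 0) :
    ((straightCurve u).crossings (straightCurve v)).encard ≤
      (((det u.1 v.1).natAbs - 1 : ℕ) : ℕ∞) := by
  rw [← encard_Ioo_zero_abs]
  let f : ℤ → Torus := fun j =>
    (((j / |(det u.1 v.1 : ℝ)| * u.1.1 : ℝ) : AddCircle (1 : ℝ)),
      ((j / |(det u.1 v.1 : ℝ)| * u.1.2 : ℝ) : AddCircle (1 : ℝ)))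
  refine le_trans (Set.encard_le_encard ?_) (Set.encard_image_le f _)
  rintro q ⟨⟨⟨s, rfl⟩, ⟨t, hts⟩⟩, hq⟩
  have hDpos : 0 < |(det u.1 v.1 : ℝ)| := abs_pos.2 (by exact_mod_cast hD)
  obtain ⟨m, hm⟩ := coe_eq_coe_iff_exists_int.1 (congrArg Prod.fst hts)
  obtain ⟨n, hn⟩ := coe_eq_coe_iff_exists_int.1 (congrArg Prod.snd hts)
  -- Since tv - su is a lattice vector, its determinant with v makes s · det(u, v) an integer.
  obtain ⟨j, hj⟩ : ∃ j : ℤ, (s : ℝ) * |(det u.1 v.1 : ℝ)| = j := by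
    have hk : (s : ℝ) * (det u.1 v.1 : ℝ) = (n * v.1.1 - m * v.1.2 : ℤ) := by
      simp only [det]
      push_cast
      linear_combination v.1.1 * hn - v.1.2 * hm
    rcases abs_choice (det u.1 v.1 : ℝ) with h | h
    · exact ⟨_, by rw [h, hk]⟩
    · exact ⟨-(n * v.1.1 - m * v.1.2), by rw [h, mul_neg, hk, Int.cast_neg]⟩
  have hs0 : (s : ℝ) ≠ 0 := fun h => hq (by
    rw [show s = 0 from Subtype.ext h]
    exact (straightCurve u).path.source)
  have hs1 : (s : ℝ) ≠ 1 := fun h => hq (by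
    rw [show s = 1 from Subtype.ext h]
    exact (straightCurve u).path.target)
  have h0 : (0 : ℝ) < s := lt_of_le_of_ne s.2.1 hs0.symm
  have h1 : (s : ℝ) < 1 := lt_of_le_of_ne s.2.2 hs1
  refine ⟨j, ⟨?_, ?_⟩, ?_⟩
  · have : (0 : ℝ) < j := hj ▸ mul_pos h0 hDpos
    exact_mod_cast this
  · have : (j : ℝ) < |(det u.1 v.1 : ℝ)| := by
      rw [← hj]
      nlinarith
    exact_mod_cast this
  · have : (j : ℝ) / |(det u.1 v.1 : ℝ)| = s := by
      rw [← hj]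
      field_simp
    simp only [f, this]
    exact ((isLift_straightCurve u).apply_eq s).symm

/-- If the determinant vanishes, a Bézout relation for v writes u = kv with k an integer;
primitivity of u makes k a unit. -/
theorem det_ne_zero_of_arcOf_ne {u v : PrimitiveVector} (h : arcOf u ≠ arcOf v) :
    det u.1 v.1 ≠ 0 := by
  intro h0
  apply h
  rw [arcOf_eq_arcOf_iff]
  obtain ⟨a, b, hab⟩ := u.2
  obtain ⟨c, d, hcd⟩ := v.2
  simp only [det] at h0
  have e1 : u.1.1 = (c * u.1.1 + d * u.1.2) * v.1.1 := by linear_combination (-u.1.1) * hcd + d * h0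
  have e2 : u.1.2 = (c * u.1.1 + d * u.1.2) * v.1.2 := by linear_combination (-u.1.2) * hcd - c * h0
  generalize c * u.1.1 + d * u.1.2 = k at e1 e2
  have hk : k * (a * v.1.1 + b * v.1.2) = 1 := by
    linear_combination hab - a * e1 - b * e2
  rcases Int.eq_one_or_neg_one_of_mul_eq_one hk with rfl | rfl
  · exact Or.inl (Prod.ext (by simpa using e1) (by simpa using e2))
  · exact Or.inr (Prod.ext (by simpa using e1) (by simpa using e2))

theorem natAbs_det_sub_one_le {u v : PrimitiveVector} (h : arcOf u ≠ arcOf v) {γ δ : ArcCurve}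
    (hγ : γ.arc = arcOf u) (hδ : δ.arc = arcOf v) :
    (((det u.1 v.1).natAbs - 1 : ℕ) : ℕ∞) ≤ (γ.crossings δ).encard := by
  obtain ⟨x, y, u', hu⟩ := exists_isLift γ.path
  obtain ⟨x', y', v', hv⟩ := exists_isLift δ.path
  have h1 := (arc_eq_arc_iff hu (isLift_straightCurve u)).1 hγ
  have h2 := (arc_eq_arc_iff hv (isLift_straightCurve v)).1 hδ
  have habs : (det u' v').natAbs = (det u.1 v.1).natAbs := by
    rw [Int.natAbs_eq_natAbs_iff]
    rcases h1 with rfl | rfl <;> rcases h2 with rfl | rfl <;>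
      simp only [det, Prod.fst_neg, Prod.snd_neg]
    · left; trivial
    · right; ring
    · right; ring
    · left; ring
  rw [← habs]
  refine le_encard_crossings hu hv fun h0 => det_ne_zero_of_arcOf_ne h ?_
  rw [← Int.natAbs_eq_zero, ← habs, h0, Int.natAbs_zero]

/-- The intersection number of the arcs of independent primitive vectors. -/
theorem intersectionNumber_arcOf {u v : PrimitiveVector} (h : arcOf u ≠ arcOf v) :
    (arcOf u).intersectionNumber (arcOf v) = (det u.1 v.1).natAbs - 1 := by
  rw [Arc.intersectionNumber, if_neg h]
  have hmem : (det u.1 v.1).natAbs - 1 ∈ {n : ℕ | ∃ γ δ : ArcCurve, γ.arc = arcOf u ∧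
      δ.arc = arcOf v ∧ (γ.crossings δ).encard = n} :=
    ⟨straightCurve u, straightCurve v, rfl, rfl,
      le_antisymm (encard_crossings_straightCurve_le u v (det_ne_zero_of_arcOf_ne h))
        (natAbs_det_sub_one_le h rfl rfl)⟩
  refine le_antisymm (Nat.sInf_le hmem) (le_csInf ⟨_, hmem⟩ ?_)
  rintro n ⟨γ, δ, hγ, hδ, hn⟩
  have := natAbs_det_sub_one_le h hγ hδ
  rw [hn] at this
  exact_mod_cast this

/-- Distinct arcs are compatible if and only if their vectors form a basis of the lattice. -/
theorem compatible_arcOf_iff {u v : PrimitiveVector} (h : arcOf u ≠ arcOf v) :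
    (arcOf u).Compatible (arcOf v) ↔ (det u.1 v.1).natAbs = 1 := by
  have h0 : (det u.1 v.1).natAbs ≠ 0 := Int.natAbs_ne_zero.2 (det_ne_zero_of_arcOf_ne h)
  constructor
  · rintro ⟨γ, δ, hγ, hδ, hc⟩
    have := natAbs_det_sub_one_le h hγ hδ
    rw [hc, Set.encard_empty, nonpos_iff_eq_zero] at this
    have : (det u.1 v.1).natAbs - 1 = 0 := by exact_mod_cast this
    omega
  · intro h1
    have := encard_crossings_straightCurve_le u v (det_ne_zero_of_arcOf_ne h)
    rw [h1] at this
    exact ⟨_, _, rfl, rfl, Set.encard_eq_zero.1 (nonpos_iff_eq_zero.1 (by simpa using this))⟩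

/-! ### Triangulations and flips -/

/-- A primitive vector in the direction of an arc. -/
noncomputable def Arc.vector (α : Arc) : PrimitiveVector := Function.surjInv arcOf_surjective α

theorem arcOf_vector (α : Arc) : arcOf α.vector = α := Function.surjInv_eq arcOf_surjective α

/-- The absolute value of the determinant of the vectors of two arcs. -/
noncomputable def Arc.detAbs (α β : Arc) : ℕ := (det α.vector.1 β.vector.1).natAbs

theorem Arc.detAbs_comm (α β : Arc) : α.detAbs β = β.detAbs α := by
  rw [Arc.detAbs, Arc.detAbs, Int.natAbs_eq_natAbs_iff]
  right
  simp only [det]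
  ring

theorem Arc.detAbs_self (α : Arc) : α.detAbs α = 0 := by
  rw [Arc.detAbs, Int.natAbs_eq_zero, det]
  ring

theorem Arc.ne_of_detAbs_ne_zero {α β : Arc} (h : α.detAbs β ≠ 0) : α ≠ β := by
  rintro rfl
  exact h α.detAbs_self

theorem Arc.intersectionNumber_eq {α β : Arc} (h : α ≠ β) :
    α.intersectionNumber β = α.detAbs β - 1 := by
  have := intersectionNumber_arcOf (u := α.vector) (v := β.vector)
    (by rwa [arcOf_vector, arcOf_vector])
  rwa [arcOf_vector, arcOf_vector] at this

theorem Arc.compatible_iff {α β : Arc} (h : α ≠ β) : α.Compatible β ↔ α.detAbs β = 1 := by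
  have := compatible_arcOf_iff (u := α.vector) (v := β.vector)
    (by rwa [arcOf_vector, arcOf_vector])
  rwa [arcOf_vector, arcOf_vector] at this

theorem Arc.detAbs_arcOf (α : Arc) (u : PrimitiveVector) :
    α.detAbs (arcOf u) = (det α.vector.1 u.1).natAbs := by
  have h := arcOf_eq_arcOf_iff.1 (arcOf_vector (arcOf u))
  rw [Arc.detAbs, Int.natAbs_eq_natAbs_iff]
  rcases h with h | h <;> rw [h]
  · exact Or.inl rfl
  · right
    simp only [det, Prod.fst_neg, Prod.snd_neg]
    ring

/-- The Plücker relation: w is expanded in u and v and paired with z. -/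
theorem det_mul_det (u v w z : ℤ × ℤ) :
    det u v * det w z = det w v * det u z + det u w * det v z := by
  simp only [det]
  ring

theorem det_swap (u v : ℤ × ℤ) : det v u = -det u v := by
  simp only [det]
  ring

/-- A triple of arcs is a triangulation if and only if any two of its vectors form a basis. -/
theorem isTriangulation_iff {M : Fin 3 → Arc} :
    IsTriangulation M ↔ ∀ i j, i ≠ j → (M i).detAbs (M j) = 1 := by
  constructor
  · intro h i j hij
    exact (Arc.compatible_iff (h.distinct.ne hij)).1 (h.compatible i j hij)
  · intro h
    have hne : ∀ i j, i ≠ j → M i ≠ M j := fun i j hij =>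
      Arc.ne_of_detAbs_ne_zero (by rw [h i j hij]; exact one_ne_zero)
    refine ⟨fun i j hij => by_contra fun h' => hne i j h' hij,
      fun i j hij => (Arc.compatible_iff (hne i j hij)).2 (h i j hij), fun α hα => ?_⟩
    by_contra! hα'
    have h1 : ∀ i, α.detAbs (M i) = 1 := fun i => (Arc.compatible_iff (hα' i)).1 (hα i)
    -- Maximality comes for free by parity: with a fourth compatible arc all six determinants would
    -- be ±1, and the Plücker relation would equate an odd number with an even one.
    have e := det_mul_det (M 0).vector.1 (M 1).vector.1 α.vector.1 (M 2).vector.1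
    rw [det_swap α.vector.1 (M 0).vector.1] at e
    have a1 := h 0 1 (by decide)
    have a2 := h1 2
    have a3 := h1 1
    have a4 := h 0 2 (by decide)
    have a5 := h1 0
    have a6 := h 1 2 (by decide)
    simp only [Arc.detAbs, Int.natAbs_eq_iff, Nat.cast_one] at a1 a2 a3 a4 a5 a6
    rcases a1 with a1 | a1 <;> rcases a2 with a2 | a2 <;> rcases a3 with a3 | a3 <;>
      rcases a4 with a4 | a4 <;> rcases a5 with a5 | a5 <;> rcases a6 with a6 | a6 <;>
      rw [a1, a2, a3, a4, a5, a6] at e <;> norm_num at e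

theorem IsFlip.symm {k : Fin 3} {M M' : Fin 3 → Arc} (h : IsFlip k M M') : IsFlip k M' M :=
  ⟨h.target, h.source, fun j hj => (h.fixed j hj).symm, h.exchanged.symm⟩

/-- The coordinates of a vector in a basis. -/
theorem det_smul_eq (a b c : ℤ × ℤ) : det a b • c = det c b • a + det a c • b := by
  refine Prod.ext ?_ ?_ <;> simp only [det, Prod.smul_fst, Prod.smul_snd, Prod.fst_add,
    Prod.snd_add, smul_eq_mul] <;> ring

theorem eq_or_eq_neg_of_smul {d : ℤ} (hd : d = 1 ∨ d = -1) {u v : ℤ × ℤ}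
    (h : d • u = d • v ∨ d • u = -(d • v)) : u = v ∨ u = -v := by
  rcases hd with rfl | rfl
  · simpa using h
  · simpa [neg_eq_iff_eq_neg] using h

/-- Two arcs that complete the same pair of arcs are equal, or else the coordinates of one of them
are those of the other with one sign changed. -/
theorem coordinates_of_ne {a b c e : PrimitiveVector} (hab : (det a.1 b.1).natAbs = 1)
    (hca : (det a.1 c.1).natAbs = 1) (hcb : (det c.1 b.1).natAbs = 1)
    (hea : (det a.1 e.1).natAbs = 1) (heb : (det e.1 b.1).natAbs = 1) (hne : arcOf c ≠ arcOf e) :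
    det c.1 b.1 * det a.1 c.1 = -(det e.1 b.1 * det a.1 e.1) := by
  by_contra h
  apply hne
  rw [arcOf_eq_arcOf_iff]
  simp only [Int.natAbs_eq_iff, Nat.cast_one] at hab hca hcb hea heb
  refine eq_or_eq_neg_of_smul hab ?_
  -- Equal products of the coordinates, all ±1, mean coordinate vectors that agree up to a common
  -- sign, hence equal arcs.
  rw [det_smul_eq a.1 b.1 c.1, det_smul_eq a.1 b.1 e.1]
  rcases hca with h1 | h1 <;> rcases hcb with h2 | h2 <;> rcases hea with h3 | h3 <;>
    rcases heb with h4 | h4 <;> rw [h1, h2, h3, h4] at h ⊢ <;>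
    first | simp [add_comm]; done | exact absurd (by norm_num) h

theorem isFlip_of_ne {M : Fin 3 → Arc} (hM : IsTriangulation M) {k : Fin 3} {α : Arc}
    (hα : α ≠ M k) (h : ∀ i, i ≠ k → α.detAbs (M i) = 1) :
    IsFlip k M (Function.update M k α) where
  source := hM
  target := by
    rw [isTriangulation_iff] at hM ⊢
    intro i j hij
    by_cases hi : i = k
    · subst hi
      rw [Function.update_self, Function.update_of_ne hij.symm]
      exact h j hij.symm
    · rw [Function.update_of_ne hi]
      by_cases hj : j = k
      · subst hj
        rw [Function.update_self, Arc.detAbs_comm]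
        exact h i hij
      · rw [Function.update_of_ne hj]
        exact hM i j hij
  fixed j hj := Function.update_of_ne hj _ _
  exchanged := by rwa [Function.update_self]

theorem exists_other_indices (k : Fin 3) : ∃ i j : Fin 3, i ≠ k ∧ j ≠ k ∧ i ≠ j ∧
    ∀ l, l ≠ k → l = i ∨ l = j := by
  revert k
  decide

/-- There is exactly one flip of a triangulation in each direction. -/
theorem existsUnique_isFlip {M : Fin 3 → Arc} (hM : IsTriangulation M) (k : Fin 3) :
    ∃! M', IsFlip k M M' := by
  obtain ⟨i, j, hi, hj, hij, hall⟩ := exists_other_indices k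
  have hM' := isTriangulation_iff.1 hM
  obtain ⟨a, ha⟩ : ∃ a, a = (M i).vector := ⟨_, rfl⟩
  obtain ⟨b, hb⟩ : ∃ b, b = (M j).vector := ⟨_, rfl⟩
  obtain ⟨c, hc⟩ : ∃ c, c = (M k).vector := ⟨_, rfl⟩
  have hab : (det a.1 b.1).natAbs = 1 := by rw [ha, hb]; exact hM' i j hij
  have hac : (det a.1 c.1).natAbs = 1 := by rw [ha, hc]; exact hM' i k hi
  have hcb : (det c.1 b.1).natAbs = 1 := by rw [hc, hb]; exact hM' k j hj.symm
  -- The expansion of ±c in the basis a, b with its second coordinate negated.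
  obtain ⟨e, he⟩ : ∃ e : ℤ × ℤ, e = det c.1 b.1 • a.1 - det a.1 c.1 • b.1 := ⟨_, rfl⟩
  have hae : det a.1 e = -(det a.1 c.1 * det a.1 b.1) := by
    rw [he]
    simp only [det, Prod.fst_sub, Prod.snd_sub, Prod.smul_fst, Prod.smul_snd, smul_eq_mul]
    ring
  have hbe : det b.1 e = -(det c.1 b.1 * det a.1 b.1) := by
    rw [he]
    simp only [det, Prod.fst_sub, Prod.snd_sub, Prod.smul_fst, Prod.smul_snd, smul_eq_mul]
    ring
  have hce : det c.1 e = -(2 * (det c.1 b.1 * det a.1 c.1)) := by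
    rw [he]
    simp only [det, Prod.fst_sub, Prod.snd_sub, Prod.smul_fst, Prod.smul_snd, smul_eq_mul]
    ring
  have hae1 : (det a.1 e).natAbs = 1 := by rw [hae, Int.natAbs_neg, Int.natAbs_mul, hac, hab]
  have hbe1 : (det b.1 e).natAbs = 1 := by rw [hbe, Int.natAbs_neg, Int.natAbs_mul, hcb, hab]
  have hce2 : (det c.1 e).natAbs = 2 := by
    rw [hce, Int.natAbs_neg, Int.natAbs_mul, Int.natAbs_mul, hac, hcb]
    rfl
  have hprim : IsCoprime e.1 e.2 := by
    rcases Int.natAbs_eq_iff.1 hae1 with h | h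
    · exact ⟨-a.1.2, a.1.1, by simp only [det] at h; push_cast at h; linear_combination h⟩
    · exact ⟨a.1.2, -a.1.1, by simp only [det] at h; push_cast at h; linear_combination -h⟩
  let E : PrimitiveVector := ⟨e, hprim⟩
  have hdet : ∀ l, (arcOf E).detAbs (M l) = (det (M l).vector.1 e).natAbs := fun l => by
    rw [Arc.detAbs_comm, Arc.detAbs_arcOf]
  refine ⟨Function.update M k (arcOf E), isFlip_of_ne hM ?_ ?_, ?_⟩
  · apply Arc.ne_of_detAbs_ne_zero
    rw [hdet, ← hc, hce2]
    exact two_ne_zero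
  · intro l hl
    rw [hdet]
    rcases hall l hl with rfl | rfl
    · rw [← ha, hae1]
    · rw [← hb, hbe1]
  · intro M'' h
    have hT := isTriangulation_iff.1 h.target
    funext l
    by_cases hl : l = k
    · subst hl
      rw [Function.update_self]
      by_contra hne
      have h1 : (det a.1 (M'' l).vector.1).natAbs = 1 := by
        rw [ha, ← h.fixed i hi]
        exact hT i l hi
      have h2 : (det (M'' l).vector.1 b.1).natAbs = 1 := by
        rw [hb, ← h.fixed j hj]
        exact hT l j hj.symm
      have h3 : (det e b.1).natAbs = 1 := by rw [det_swap, Int.natAbs_neg, hbe1]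
      -- Three different completions of a, b would have coordinate products that are pairwise
      -- opposite, so zero, whereas these products are ±1.
      have e1 := coordinates_of_ne hab hac hcb h1 h2
        (by rw [hc, arcOf_vector, arcOf_vector]; exact h.exchanged.symm)
      have e2 := coordinates_of_ne (e := E) hab h1 h2 hae1 h3 (by rwa [arcOf_vector])
      have e3 := coordinates_of_ne (e := E) hab hac hcb hae1 h3 (by
        rw [hc, arcOf_vector]
        apply Arc.ne_of_detAbs_ne_zero
        rw [Arc.detAbs_comm, hdet, ← hc, hce2]
        exact two_ne_zero)
      have h0 : det c.1 b.1 * det a.1 c.1 = 0 := by linarith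
      have : (det c.1 b.1 * det a.1 c.1).natAbs = 1 := by rw [Int.natAbs_mul, hac, hcb]
      rw [h0] at this
      exact absurd this (by decide)
    · rw [Function.update_of_ne hl, h.fixed l hl]

/-- If the determinant of `ℓ` with the flipped arc is not the sum of those with the two other arcs,
it becomes this sum. -/
theorem IsFlip.detAbs_eq_add {k : Fin 3} {M M' : Fin 3 → Arc} (h : IsFlip k M M') (ℓ : Arc)
    {i j : Fin 3} (hi : i ≠ k) (hj : j ≠ k) (hij : i ≠ j)
    (hne : ℓ.detAbs (M k) ≠ ℓ.detAbs (M i) + ℓ.detAbs (M j)) :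
    ℓ.detAbs (M' k) = ℓ.detAbs (M i) + ℓ.detAbs (M j) := by
  have hS := isTriangulation_iff.1 h.source
  have hT := isTriangulation_iff.1 h.target
  have h1 : (M i).detAbs (M' k) = 1 := by
    rw [← h.fixed i hi]
    exact hT i k hi
  have h2 : (M' k).detAbs (M j) = 1 := by
    rw [← h.fixed j hj]
    exact hT k j hj.symm
  have h3 := hS i j hij
  have h4 := hS i k hi
  have h5 := hS k j hj.symm
  have e := coordinates_of_ne h3 h4 h5 h1 h2
    (by rw [arcOf_vector, arcOf_vector]; exact h.exchanged.symm)
  have e1 := det_mul_det (M i).vector.1 (M j).vector.1 (M k).vector.1 ℓ.vector.1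
  have e2 := det_mul_det (M i).vector.1 (M j).vector.1 (M' k).vector.1 ℓ.vector.1
  rw [Arc.detAbs_comm ℓ, Arc.detAbs_comm ℓ (M i), Arc.detAbs_comm ℓ (M j)] at *
  simp only [Arc.detAbs] at *
  generalize det (M i).vector.1 ℓ.vector.1 = A at *
  generalize det (M j).vector.1 ℓ.vector.1 = B at *
  generalize det (M k).vector.1 ℓ.vector.1 = C at *
  generalize det (M' k).vector.1 ℓ.vector.1 = C' at *
  -- Up to sign, C and C' are A + B and A - B in some order.
  rcases Int.natAbs_eq_iff.1 h1 with h1 | h1 <;> rcases Int.natAbs_eq_iff.1 h2 with h2 | h2 <;>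
    rcases Int.natAbs_eq_iff.1 h3 with h3 | h3 <;> rcases Int.natAbs_eq_iff.1 h4 with h4 | h4 <;>
    rcases Int.natAbs_eq_iff.1 h5 with h5 | h5 <;> rw [h1, h2, h4, h5] at e <;>
    rw [h3, h4, h5] at e1 <;> rw [h1, h2, h3] at e2 <;> push_cast at e e1 e2 <;> omega

/-! ### Cluster patterns -/

open Classical in
/-- The flip of a triangulation in direction `k`. -/
noncomputable def flip (k : Fin 3) (M : Fin 3 → Arc) : Fin 3 → Arc :=
  if h : IsTriangulation M then (existsUnique_isFlip h k).choose else M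

theorem isFlip_flip (k : Fin 3) {M : Fin 3 → Arc} (h : IsTriangulation M) :
    IsFlip k M (flip k M) := by
  rw [flip, dif_pos h]
  exact (existsUnique_isFlip h k).choose_spec.1

theorem isTriangulation_foldr_flip {L : Fin 3 → Arc} (hL : IsTriangulation L)
    (w : List (Fin 3)) : IsTriangulation (w.foldr flip L) := by
  induction w with
  | nil => exact hL
  | cons k w ih => exact (isFlip_flip k ih).target

theorem existsUnique_isClusterPattern {L : Fin 3 → Arc} (hL : IsTriangulation L) :
    ∃! P : T3 → Fin 3 → Arc, IsClusterPattern L P := by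
  refine ⟨fun t => t.1.foldr flip L, ⟨rfl, ?_⟩, ?_⟩
  · rintro k t t' (h | h)
    · simp only [h, List.foldr_cons]
      exact isFlip_flip k (isTriangulation_foldr_flip hL _)
    · simp only [h, List.foldr_cons]
      exact (isFlip_flip k (isTriangulation_foldr_flip hL _)).symm
  · intro P hP
    funext ⟨w, hw⟩
    induction w with
    | nil => exact hP.initial
    | cons k w ih =>
      have h1 := hP.flip k ⟨w, hw.tail⟩ ⟨k :: w, hw⟩ (Or.inl rfl)
      rw [ih hw.tail] at h1
      exact (existsUnique_isFlip h1.source k).unique h1 (isFlip_flip k h1.source)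

/-! ### Paths in the subtree and in the Calkin–Wilf tree -/

/-- How the index pair (numerator, denominator) changes along an edge labelled `k`. -/
def nextPair (k : Fin 3) (p : Fin 3 × Fin 3) : Fin 3 × Fin 3 :=
  if k = p.1 then (thirdLabel p.1 p.2, p.2)
  else if k = p.2 then (p.1, thirdLabel p.1 p.2)
  -- On paths in the subtree this case occurs only for the first label, `2`, on the way from `t₀` to
  -- `t₁`; it keeps the initial pair (0, 1).
  else p

/-- The index pair (numerator, denominator) at the end of a path. -/
def indexPair (w : List (Fin 3)) : Fin 3 × Fin 3 := w.foldr nextPair (0, 1)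

/-- The path in the Calkin–Wilf tree that corresponds to a path in the subtree. -/
def sides : List (Fin 3) → List Side
  | [] => []
  -- The edge from `t₀` to `t₁` has no counterpart, as `t₁` is the root.
  | [_] => []
  | k :: l :: w => (if k = (indexPair (l :: w)).2 then .left else .right) :: sides (l :: w)

namespace T3'

theorem child_iff {k : Fin 3} {t t' : T3'} : T3'.Child k t t' ↔ t'.1.1 = k :: t.1.1 := by
  constructor
  · rintro ⟨h | h, hl⟩
    · exact h
    · have := congrArg List.length h
      simp only [List.length_cons] at this
      omega
  · intro h
    exact ⟨Or.inl h, by rw [h]; simp⟩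

theorem edge_iff {k : Fin 3} {t t' : T3'} :
    T3'.Edge k t t' ↔ T3'.Child k t t' ∨ T3'.Child k t' t := by
  rw [child_iff, child_iff]
  exact Iff.rfl

theorem child_induction {Q : T3' → Prop} (root : Q T3'.t1)
    (step : ∀ k t t', T3'.Child k t t' → Q t → Q t') (t : T3') : Q t := by
  obtain ⟨⟨w, hw⟩, hl⟩ := t
  induction w with
  | nil => simp at hl
  | cons k w ih =>
    rcases w with _ | ⟨l, w⟩
    · have : k = 2 := by simpa using hl
      subst this
      exact root
    · have hl' : (l :: w).getLast? = some 2 := by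
        rw [← hl]
        exact List.getLast?_cons_cons.symm
      exact step k ⟨⟨l :: w, hw.tail⟩, hl'⟩ _ (child_iff.2 rfl) (ih hw.tail hl')

theorem eq_t1_or_exists_child (t : T3') : t = T3'.t1 ∨ ∃ k s, T3'.Child k s t :=
  child_induction (Q := fun t => t = T3'.t1 ∨ ∃ k s, T3'.Child k s t) (Or.inl rfl)
    (fun k s _ h _ => Or.inr ⟨k, s, h⟩) t

theorem exists_eq_cons (t : T3') : ∃ l w, t.1.1 = l :: w := by
  rcases h : t.1.1 with _ | ⟨l, w⟩
  · have := t.2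
    rw [h] at this
    simp at this
  · exact ⟨l, w, rfl⟩

theorem ext_list {t t' : T3'} (h : t.1.1 = t'.1.1) : t = t' := Subtype.ext (Subtype.ext h)

theorem Child.unique {k : Fin 3} {t t' t'' : T3'} (h : T3'.Child k t t') (h' : T3'.Child k t t'') :
    t' = t'' := ext_list ((child_iff.1 h).trans (child_iff.1 h').symm)

/-- The index of the numerator. -/
def num (t : T3') : Fin 3 := (indexPair t.1.1).1

/-- The index of the denominator. -/
def den (t : T3') : Fin 3 := (indexPair t.1.1).2

/-- The label of the edge that leads to a vertex. -/
def last (t : T3') : Fin 3 := t.1.1.headD 2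

theorem Child.last_eq {k : Fin 3} {t t' : T3'} (h : T3'.Child k t t') : last t' = k := by
  rw [last, child_iff.1 h]
  rfl

theorem Child.ne_last {k : Fin 3} {t t' : T3'} (h : T3'.Child k t t') : k ≠ last t := by
  obtain ⟨l, w, hw⟩ := exists_eq_cons t
  have h1 := child_iff.1 h
  have h2 := t'.1.2
  rw [h1, hw] at h2
  rw [last, hw]
  exact (List.isChain_cons_cons.1 h2).1

theorem Child.indexPair_eq {k : Fin 3} {t t' : T3'} (h : T3'.Child k t t') :
    indexPair t'.1.1 = nextPair k (num t, den t) := by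
  rw [child_iff.1 h]
  rfl

theorem exists_child {k : Fin 3} {t : T3'} (h : k ≠ last t) : ∃ t', T3'.Child k t t' := by
  obtain ⟨l, w, hw⟩ := exists_eq_cons t
  have hkl : k ≠ l := by
    rw [last, hw] at h
    exact h
  have hc : (k :: t.1.1).IsChain (· ≠ ·) := by
    have := t.1.2
    rw [hw] at this ⊢
    exact List.isChain_cons_cons.2 ⟨hkl, this⟩
  have hl : (k :: t.1.1).getLast? = some 2 := by
    have := t.2
    rw [hw] at this ⊢
    rw [← this]
    exact List.getLast?_cons_cons
  exact ⟨⟨⟨_, hc⟩, hl⟩, child_iff.2 rfl⟩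

/-- The flipped index leaves the pair and the previously flipped one enters it. So the edges away
from the root carry exactly the two labels of the index pair. -/
theorem labels_distinct (t : T3') : num t ≠ den t ∧ last t = thirdLabel (num t) (den t) := by
  induction t using child_induction with
  | root => decide
  | step k t t' h ih =>
    have h1 := h.ne_last
    have h2 := h.last_eq
    have h3 := h.indexPair_eq
    rw [h2, num, den, h3]
    rw [ih.2] at h1
    have ih1 := ih.1
    generalize num t = a at *
    generalize den t = b at *
    clear h2 h3 ih h
    revert k a b
    decide

theorem num_ne_den (t : T3') : num t ≠ den t := (labels_distinct t).1

theorem last_ne_num (t : T3') : last t ≠ num t := by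
  rw [(labels_distinct t).2]
  exact (thirdLabel_ne _ _ (num_ne_den t)).1

theorem last_ne_den (t : T3') : last t ≠ den t := by
  rw [(labels_distinct t).2]
  exact (thirdLabel_ne _ _ (num_ne_den t)).2

theorem eq_last {t : T3'} {c : Fin 3} (h1 : c ≠ num t) (h2 : c ≠ den t) : c = last t := by
  have h3 := last_ne_num t
  have h4 := last_ne_den t
  have h5 := num_ne_den t
  omega

theorem Child.eq_num_or_den {k : Fin 3} {t t' : T3'} (h : T3'.Child k t t') :
    k = num t ∨ k = den t := by
  by_contra! h'
  exact h.ne_last (eq_last h'.1 h'.2)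

theorem Child.of_num {t t' : T3'} (h : T3'.Child (num t) t t') :
    num t' = last t ∧ den t' = den t := by
  rw [num, den, h.indexPair_eq, nextPair, if_pos rfl, (labels_distinct t).2]
  exact ⟨rfl, rfl⟩

theorem Child.of_den {t t' : T3'} (h : T3'.Child (den t) t t') :
    num t' = num t ∧ den t' = last t := by
  rw [num, den, h.indexPair_eq, nextPair, if_neg (num_ne_den t).symm, if_pos rfl,
    (labels_distinct t).2]
  exact ⟨rfl, rfl⟩

theorem num_t1 : num T3'.t1 = 0 := by decide

theorem den_t1 : den T3'.t1 = 1 := by decide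

theorem last_t1 : last T3'.t1 = 2 := by decide

theorem Child.sides_eq {k : Fin 3} {t t' : T3'} (h : T3'.Child k t t') :
    sides t'.1.1 = (if k = den t then .left else .right) :: sides t.1.1 := by
  obtain ⟨l, w, hw⟩ := exists_eq_cons t
  rw [child_iff.1 h, den, hw, sides]

theorem sides_injective {t t' : T3'} (h : sides t.1.1 = sides t'.1.1) : t = t' := by
  induction t using child_induction generalizing t' with
  | root =>
    rcases eq_t1_or_exists_child t' with rfl | ⟨k, s, hs⟩
    · rfl
    · rw [hs.sides_eq] at h
      simp [T3'.t1, sides] at h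
  | step k t u hu ih =>
    rcases eq_t1_or_exists_child t' with rfl | ⟨l, s, hs⟩
    · rw [hu.sides_eq] at h
      simp [T3'.t1, sides] at h
    · rw [hu.sides_eq, hs.sides_eq, List.cons.injEq] at h
      obtain ⟨h1, h2⟩ := h
      obtain rfl := ih h2
      have hd := num_ne_den t
      have : k = l := by
        rcases hu.eq_num_or_den with rfl | rfl <;> rcases hs.eq_num_or_den with rfl | rfl
        · rfl
        · simp [hd] at h1
        · simp [hd] at h1
        · rfl
      subst this
      exact hu.unique hs

/-- The label of the edge to the child on the given side. -/
def sideLabel (t : T3') : Side → Fin 3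
  | .left => den t
  | .right => num t

theorem exists_child_sideLabel (t : T3') (s : Side) :
    ∃ t', T3'.Child (sideLabel t s) t t' ∧ sides t'.1.1 = s :: sides t.1.1 := by
  cases s with
  | left =>
    obtain ⟨t', h⟩ := exists_child (last_ne_den t).symm
    exact ⟨t', h, by rw [h.sides_eq, if_pos rfl]⟩
  | right =>
    obtain ⟨t', h⟩ := exists_child (last_ne_num t).symm
    exact ⟨t', h, by rw [h.sides_eq, if_neg (num_ne_den t)]⟩

theorem sides_surjective (p : List Side) : ∃ t : T3', sides t.1.1 = p := by
  induction p with
  | nil => exact ⟨T3'.t1, rfl⟩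
  | cons s p ih =>
    obtain ⟨t, rfl⟩ := ih
    obtain ⟨t', -, h⟩ := exists_child_sideLabel t s
    exact ⟨t', h⟩

/-- The vertices of the subtree correspond to those of the Calkin–Wilf tree. -/
noncomputable def equivSides : T3' ≃ List Side :=
  Equiv.ofBijective (fun t => sides t.1.1)
    ⟨fun _ _ h => sides_injective h, sides_surjective⟩

theorem equivSides_apply (t : T3') : equivSides t = sides t.1.1 := rfl

theorem child_iff_sides {k : Fin 3} {t t' : T3'} :
    T3'.Child k t t' ↔ ∃ s : Side, sides t'.1.1 = s :: sides t.1.1 ∧ k = sideLabel t s := by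
  constructor
  · intro h
    rcases h.eq_num_or_den with rfl | rfl
    · exact ⟨.right, by rw [h.sides_eq, if_neg (num_ne_den t)], rfl⟩
    · exact ⟨.left, by rw [h.sides_eq, if_pos rfl], rfl⟩
  · rintro ⟨s, h1, rfl⟩
    obtain ⟨t'', h2, h3⟩ := exists_child_sideLabel t s
    rwa [sides_injective (h1.trans h3.symm)]

end T3'

section Growth

/-! ### The growth of the intersection vectors -/

/-- The rule by which the vectors with entries `d i + 1` grow along the subtree. -/
structure IsAdditive (e : T3' → Fin 3 → ℕ) : Prop where
  root_zero : e T3'.t1 0 = 1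
  root_one : e T3'.t1 1 = 1
  root_two : e T3'.t1 2 = 2
  fixed : ∀ (k i : Fin 3) (t t' : T3'), T3'.Child k t t' → i ≠ k → e t' i = e t i
  step : ∀ (k i j : Fin 3) (t t' : T3'), T3'.Child k t t' → i ≠ k → j ≠ k → i ≠ j →
    e t k ≠ e t i + e t j → e t' k = e t i + e t j

namespace IsAdditive

open T3'

variable {e : T3' → Fin 3 → ℕ}

/-- Since the last entry is the sum of two positive entries, neither of these is the sum of the
other two; the growth rule therefore applies at every further flip. -/
theorem invariant (he : IsAdditive e) (t : T3') :
    0 < e t (num t) ∧ 0 < e t (den t) ∧ e t (last t) = e t (num t) + e t (den t) := by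
  induction t using child_induction with
  | root => simp [num_t1, den_t1, last_t1, he.root_zero, he.root_one, he.root_two]
  | step k t t' h ih =>
    obtain ⟨h1, h2, h3⟩ := ih
    rw [h.last_eq]
    rcases h.eq_num_or_den with rfl | rfl
    · have e1 := he.fixed _ _ _ _ h (last_ne_num t)
      have e2 := he.fixed _ _ _ _ h (num_ne_den t).symm
      have e3 := he.step _ _ _ _ _ h (last_ne_num t) (num_ne_den t).symm (last_ne_den t) (by omega)
      rw [h.of_num.1, h.of_num.2, e1, e2, e3]
      omega
    · have e1 := he.fixed _ _ _ _ h (last_ne_den t)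
      have e2 := he.fixed _ _ _ _ h (num_ne_den t)
      have e3 := he.step _ _ _ _ _ h (num_ne_den t) (last_ne_den t) (last_ne_num t).symm (by omega)
      rw [h.of_den.1, h.of_den.2, e1, e2, e3]
      omega

theorem pos (he : IsAdditive e) (t : T3') (i : Fin 3) : 0 < e t i := by
  obtain ⟨h1, h2, h3⟩ := he.invariant t
  by_cases hn : i = num t
  · rwa [hn]
  by_cases hd : i = den t
  · rwa [hd]
  rw [eq_last hn hd]
  omega

theorem lt_last (he : IsAdditive e) (t : T3') {i : Fin 3} (hi : i ≠ last t) :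
    e t i < e t (last t) := by
  obtain ⟨h1, h2, h3⟩ := he.invariant t
  by_cases hn : i = num t
  · rw [hn]; omega
  by_cases hd : i = den t
  · rw [hd]; omega
  exact absurd (eq_last hn hd) hi

/-- The last label is visible in the vector as the position of the strict maximum. -/
theorem last_eq_of_eq (he : IsAdditive e) {t t' : T3'} (h : e t = e t') : last t = last t' := by
  by_contra hne
  have h1 := he.lt_last t (i := last t') (Ne.symm hne)
  have h2 := he.lt_last t' hne
  rw [h] at h1
  omega

/-- Behind an edge, the entry at its label arises from the other two entries. -/
theorem eq_sub_or (he : IsAdditive e) {k : Fin 3} {t t' : T3'} (h : T3'.Child k t t') {i j : Fin 3}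
    (hi : i ≠ k) (hj : j ≠ k) (hij : i ≠ j) :
    e t' i + e t k = e t' j ∨ e t' j + e t k = e t' i := by
  obtain ⟨h1, h2, h3⟩ := he.invariant t
  rw [he.fixed k i t t' h hi, he.fixed k j t t' h hj]
  have h4 := last_ne_num t
  have h5 := last_ne_den t
  have h6 := num_ne_den t
  rcases h.eq_num_or_den with rfl | rfl
  · have : (i = last t ∧ j = den t) ∨ (i = den t ∧ j = last t) := by omega
    rcases this with ⟨rfl, rfl⟩ | ⟨rfl, rfl⟩ <;> omega
  · have : (i = last t ∧ j = num t) ∨ (i = num t ∧ j = last t) := by omega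
    rcases this with ⟨rfl, rfl⟩ | ⟨rfl, rfl⟩ <;> omega

/-- The entry before the flip is a difference of the two unflipped ones, which at the root would be
1 - 1 = 0, contrary to positivity. -/
theorem ne_root (he : IsAdditive e) {k : Fin 3} {t t' : T3'} (h : T3'.Child k t t') :
    e t' ≠ e T3'.t1 := by
  intro heq
  have hk : k = 2 := by rw [← h.last_eq, he.last_eq_of_eq heq, last_t1]
  subst hk
  have h1 := he.eq_sub_or h (i := 0) (j := 1) (by decide) (by decide) (by decide)
  rw [heq, he.root_zero, he.root_one] at h1
  have := he.pos t 2
  omega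

/-- A vector determines the last label by its maximum, and then the parent's vector: the old entry
at that label is the difference of the two others. -/
theorem injective (he : IsAdditive e) : Function.Injective e := by
  intro t t' h
  induction t using child_induction generalizing t' with
  | root =>
    rcases eq_t1_or_exists_child t' with rfl | ⟨k, s, hs⟩
    · rfl
    · exact absurd h.symm (he.ne_root hs)
  | step k t u hu ih =>
    rcases eq_t1_or_exists_child t' with rfl | ⟨l, s, hs⟩
    · exact absurd h (he.ne_root hu)
    · have hkl : k = l := by rw [← hu.last_eq, ← hs.last_eq, he.last_eq_of_eq h]
      subst hkl
      have hts : e t = e s := by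
        funext i
        by_cases hi : i = k
        · subst hi
          obtain ⟨a, b, ha, hb, hab, -⟩ := exists_other_indices i
          have h1 := he.eq_sub_or hu ha hb hab
          have h2 := he.eq_sub_or hs ha hb hab
          rw [← h] at h2
          have := he.pos t i
          have := he.pos s i
          omega
        · rw [← he.fixed k i t u hu hi, ← he.fixed k i s t' hs hi, h]
      obtain rfl := ih hts
      exact hu.unique hs

/-- Flipping the numerator index replaces the numerator by the last entry, the sum of both, which is
the right child; the denominator index gives the left child. The labels follow along. -/
theorem cwNode_sides (he : IsAdditive e) (t : T3') :
    cwNode (sides t.1.1) = ⟨e t (num t), e t (den t), den t, num t⟩ := by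
  induction t using child_induction with
  | root =>
    rw [num_t1, den_t1, he.root_zero, he.root_one]
    rfl
  | step k t t' h ih =>
    obtain ⟨h1, h2, h3⟩ := he.invariant t
    have hlast : thirdLabel (den t) (num t) = last t := by
      rw [(labels_distinct t).2, thirdLabel, thirdLabel, add_comm]
    rw [h.sides_eq, cwNode, ih]
    rcases h.eq_num_or_den with rfl | rfl
    · rw [if_neg (num_ne_den t), CWNode.child, h.of_num.1, h.of_num.2,
        he.fixed _ _ _ _ h (last_ne_num t), he.fixed _ _ _ _ h (num_ne_den t).symm, h3]
      simp only [hlast]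
    · rw [if_pos rfl, CWNode.child, h.of_den.1, h.of_den.2,
        he.fixed _ _ _ _ h (last_ne_den t), he.fixed _ _ _ _ h (num_ne_den t), h3]
      simp only [hlast]

theorem edge_iff (he : IsAdditive e) (k : Fin 3) (t t' : T3') :
    T3'.Edge k t t' ↔ calkinWilfTree.Edge k (equivSides t) (equivSides t') := by
  have hlabel : ∀ (t : T3') (s : Side), (cwNode (sides t.1.1)).label s = sideLabel t s := by
    intro t s
    rw [he.cwNode_sides]
    cases s <;> rfl
  rw [T3'.edge_iff, child_iff_sides, child_iff_sides, ← exists_or]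
  simp only [calkinWilfTree, equivSides_apply, hlabel]

/-! ### Existence and uniqueness of the ratio map -/

variable {d : T3' → Fin 3 → ℕ}

/-- The indices and the values of a ratio map are determined. -/
theorem eq_of_isRatioMap (he : IsAdditive fun t i => d t i + 1) {num' den' : T3' → Fin 3}
    {h : Set.range d → ℚ} (hh : IsRatioMap d num' den' h) (t : T3') :
    num' t = num t ∧ den' t = den t ∧
      h ⟨d t, t, rfl⟩ = ((d t (num t) : ℚ) + 1) / ((d t (den t) : ℚ) + 1) := by
  have hfix : ∀ (k i : Fin 3) (t t' : T3'), T3'.Child k t t' → i ≠ k → d t' i = d t i := by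
    intro k i t t' hc hi
    have := he.fixed k i t t' hc hi
    simpa using this
  induction t using child_induction with
  | root => exact ⟨hh.num_root.trans num_t1.symm, hh.den_root.trans den_t1.symm, hh.root⟩
  | step k t t' hc ih =>
    obtain ⟨h1, h2, -⟩ := ih
    rcases hc.eq_num_or_den with rfl | rfl
    · obtain ⟨h3, h4, h5⟩ := hh.step_num _ (last t) t t' hc (by rw [h1]; exact last_ne_num t)
        (by rw [h2]; exact last_ne_den t) h1.symm
      rw [h3, h4, h5, hc.of_num.1, hc.of_num.2, h2, hfix _ _ _ _ hc (last_ne_num t),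
        hfix _ _ _ _ hc (num_ne_den t).symm]
      exact ⟨rfl, rfl, rfl⟩
    · obtain ⟨h3, h4, h5⟩ := hh.step_den _ (last t) t t' hc (by rw [h1]; exact last_ne_num t)
        (by rw [h2]; exact last_ne_den t) h2.symm
      rw [h3, h4, h5, hc.of_den.1, hc.of_den.2, h1, hfix _ _ _ _ hc (last_ne_den t),
        hfix _ _ _ _ hc (num_ne_den t)]
      exact ⟨rfl, rfl, rfl⟩

theorem existsUnique_isRatioMap (he : IsAdditive fun t i => d t i + 1) :
    ∃! h : Set.range d → ℚ, ∃ num den : T3' → Fin 3, IsRatioMap d num den h := by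
  have hinj : Function.Injective d := fun t t' h => he.injective (by simp only [h])
  have hfix : ∀ (k i : Fin 3) (t t' : T3'), T3'.Child k t t' → i ≠ k → d t' i = d t i := by
    intro k i t t' hc hi
    have := he.fixed k i t t' hc hi
    simpa using this
  -- The index pair is read off at a chosen vertex carrying the vector; by injectivity there is only
  -- one.
  let h : Set.range d → ℚ := fun v =>
    ((v.1 (num v.2.choose) : ℚ) + 1) / ((v.1 (den v.2.choose) : ℚ) + 1)
  have hval : ∀ t, h ⟨d t, t, rfl⟩ = ((d t (num t) : ℚ) + 1) / ((d t (den t) : ℚ) + 1) := by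
    intro t
    have ht : (⟨d t, t, rfl⟩ : Set.range d).2.choose = t :=
      hinj (⟨d t, t, rfl⟩ : Set.range d).2.choose_spec
    simp only [h, ht]
  refine ⟨h, ⟨num, den, ⟨num_t1, den_t1, ?_, ?_, ?_⟩⟩, ?_⟩
  · rw [hval, num_t1, den_t1]
  · rintro k c t t' hc h1 h2 rfl
    obtain rfl := eq_last h1 h2
    rw [hval, hc.of_num.1, hc.of_num.2, hfix _ _ _ _ hc (last_ne_num t),
      hfix _ _ _ _ hc (num_ne_den t).symm]
    exact ⟨rfl, rfl, rfl⟩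
  · rintro k c t t' hc h1 h2 rfl
    obtain rfl := eq_last h1 h2
    rw [hval, hc.of_den.1, hc.of_den.2, hfix _ _ _ _ hc (last_ne_den t),
      hfix _ _ _ _ hc (num_ne_den t)]
    exact ⟨rfl, rfl, rfl⟩
  · rintro h' ⟨num', den', hh⟩
    funext ⟨_, t, rfl⟩
    rw [hval]
    exact (he.eq_of_isRatioMap hh t).2.2

end IsAdditive

end Growth

/-- The intersection vectors of a cluster pattern grow additively. -/
theorem isAdditive_initialVector {L : Fin 3 → Arc} (hL : IsTriangulation L)
    {P : T3 → Fin 3 → Arc} (hP : IsClusterPattern L P) :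
    IsAdditive fun t i => initialVector P (L 2) t i + 1 := by
  have hdet := isTriangulation_iff.1 hL
  have h0 := hP.flip 2 T3.t0 T3'.t1.1 (Or.inl rfl)
  have hflip : ∀ (k : Fin 3) (t t' : T3'), T3'.Child k t t' → IsFlip k (P t.1) (P t'.1) :=
    fun k t t' h => hP.flip k t.1 t'.1 h.1
  have hadd : IsAdditive fun t i => (L 2).detAbs (P t.1 i) := by
    refine ⟨?_, ?_, ?_, ?_, ?_⟩
    · rw [h0.fixed 0 (by decide), hP.initial]
      exact hdet 2 0 (by decide)
    · rw [h0.fixed 1 (by decide), hP.initial]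
      exact hdet 2 1 (by decide)
    -- The flip replaces ℓ₃ itself, whose determinant 0 is not 1 + 1, so the new entry is 2.
    · rw [h0.detAbs_eq_add (L 2) (i := 0) (j := 1) (by decide) (by decide) (by decide)] <;>
        rw [hP.initial, hdet 2 0 (by decide), hdet 2 1 (by decide)]
      rw [Arc.detAbs_self]
      decide
    · intro k i t t' h hi
      simp only [(hflip k t t' h).fixed i hi]
    · intro k i j t t' h hi hj hij hne
      exact (hflip k t t' h).detAbs_eq_add (L 2) hi hj hij hne
  have heq : (fun t i => initialVector P (L 2) t i + 1) = fun t i => (L 2).detAbs (P t.1 i) := by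
    funext t i
    -- Positivity shows that ℓ₃ never reappears in the subtree. The convention for the
    -- self-intersection number is thus never used, and d + 1 is the determinant without truncation.
    have hpos : 0 < (L 2).detAbs (P t.1 i) := hadd.pos t i
    rw [initialVector, intersectionVector,
      Arc.intersectionNumber_eq (Arc.ne_of_detAbs_ne_zero hpos.ne')]
    omega
  rw [heq]
  exact hadd

end PuncturedTorus

theorem theorem4p3 (L : Fin 3 → PuncturedTorus.Arc) (hL : PuncturedTorus.IsTriangulation L) :
    (∃! P : PuncturedTorus.T3 → Fin 3 → PuncturedTorus.Arc,
      PuncturedTorus.IsClusterPattern L P) ∧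
    ∀ P : PuncturedTorus.T3 → Fin 3 → PuncturedTorus.Arc, PuncturedTorus.IsClusterPattern L P →
      (∃! h : Set.range (PuncturedTorus.initialVector P (L 2)) → ℚ,
        ∃ num den : PuncturedTorus.T3' → Fin 3,
          PuncturedTorus.IsRatioMap (PuncturedTorus.initialVector P (L 2)) num den h) ∧
      ∀ (h : Set.range (PuncturedTorus.initialVector P (L 2)) → ℚ)
        (num den : PuncturedTorus.T3' → Fin 3),
        PuncturedTorus.IsRatioMap (PuncturedTorus.initialVector P (L 2)) num den h →
          ((PuncturedTorus.initialIntersectionVectorTree P (L 2)).replace h).Same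
            (PuncturedTorus.calkinWilfTree.replace PuncturedTorus.fractionValue) ∧
          (PuncturedTorus.writtenFractionTree (PuncturedTorus.initialVector P (L 2)) num den).Same
            PuncturedTorus.calkinWilfTree := by
  refine ⟨PuncturedTorus.existsUnique_isClusterPattern hL, fun P hP => ?_⟩
  have he := PuncturedTorus.isAdditive_initialVector hL hP
  have hnode := fun t => congrArg
    (fun n => (PuncturedTorus.CWNode.x n, PuncturedTorus.CWNode.y n)) (he.cwNode_sides t)
  refine ⟨he.existsUnique_isRatioMap, fun h num den hh => ⟨?_, ?_⟩⟩
  · refine ⟨PuncturedTorus.T3'.equivSides, rfl, he.edge_iff, fun t => ?_⟩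
    refine (he.eq_of_isRatioMap hh t).2.2.trans ?_
    refine Eq.trans ?_ (congrArg PuncturedTorus.fractionValue (hnode t)).symm
    simp only [PuncturedTorus.fractionValue]
    push_cast
    rfl
  · refine ⟨PuncturedTorus.T3'.equivSides, rfl, he.edge_iff, fun t => ?_⟩
    obtain ⟨h1, h2, -⟩ := he.eq_of_isRatioMap hh t
    refine Eq.trans ?_ (hnode t).symm
    simp only [PuncturedTorus.writtenFractionTree, h1, h2]
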